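/- **Lemma 10 (Convergence to projection).** Fix constants $\eta,\rho>0$ and $s_{c,0},s_{c,1},s_{d,0},s_{d,1}\ge 0$. For $n\in\mathbb N$ let $G^n=(G^n_t)_{t\ge0}$ be the continuous-time Markov chain with right-continuous paths on the simple graphs with vertex set $[n]=\{1,\dots,n\}$ and vertex colours in $\{0,1\}$ in which, given the current state, * every vertex flips its colour at rate $\eta m$, where $m$ is the number of its neighbours of the opposite colour; * every pair of distinct vertices switches its edge at rate $\rho s_{c,0}$ (edge absent) or $\rho s_{c,1}$ (edge present) if the two vertices have the same colour, and at rate $\rho s_{d,0}$ (absent) or $\rho s_{d,1}$ (present) if they have different colours. The initial states $G^n_0$ are deterministic. A coloured graphon is a pair $(\kappa,c)$ of measurable functions $\kappa:[0,1]^2\to[0,1]$, symmetric, and $c:[0,1]\to[0,1]$. A coloured graph $G$ on $[n]$ is identified with the coloured graphon $(\kappa^G,c^G)$, where $\kappa^G(x,y)=1$ if there is an edge between the vertices $\lceil nx\rceil$ and $\lceil ny\rceil$ and $\kappa^G(x,y)=0$ otherwise, and $c^G(x)$ is the colour of the vertex $\lceil nx\rceil$ (for $x=0$ read $\lceil nx\rceil$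 as $1$). For a coloured graph $F$ on $[m]$ with colours $c^F_i$ and edge set $E(F)$ put $$t_F(\kappa,c)=\int_{[0,1]^m}\prod_{\{i,j\}\in E(F)}\kappa(x_i,x_j)\prod_{i=1}^m c(x_i)^{c^F_i}(1-c(x_i))^{1-c^F_i}\,dx_1\cdots dx_m ,$$ and, for an enumeration $(F_i)_{i\ge1}$ of the isomorphism classes of finite coloured graphs (with at least one vertex), $$d_{\mathrm{sub}}\bigl((\kappa_1,c_1),(\kappa_2,c_2)\bigr)=\sum_{i\ge1}2^{-i}\,\bigl|t_{F_i}(\kappa_1,c_1)-t_{F_i}(\kappa_2,c_2)\bigr| .$$ Put $\nu(\kappa)=\inf_{x,y\in[0,1]}\int_0^1\kappa(x,z)\kappa(z,y)\,dz$. The projection is $\mathcal P(\kappa,c)=(\kappa,\bar c)$, where $\bar c$ is the constant function with value $\int_0^1c(x)\,dx$. For measurable paths $x,y$ of coloured graphons put $$d_{\mathrm m}(x,y)=\int_0^\infty\bigl(1\wedge d_{\mathrm{sub}}(x_t,y_t)\bigr)e^{-t}\,dt .$$ Let $X^n_t=(\kappa^n_t,c^n_t)$ be the coloured graphon of $G^n_t$.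 Suppose that there is a coloured graphon $(\kappa',c')$ with $\lim_{n\to\infty}d_{\mathrm{sub}}\bigl(X^n_0,(\kappa',c')\bigr)=0$, and that $\liminf_{n\to\infty}\nu(\kappa^n_0)>0$. Then, for every choice of the enumeration $(F_i)$, $$\lim_{n\to\infty}\mathbb E\bigl[d_{\mathrm m}\bigl(X^n,\mathcal P(X^n)\bigr)\bigr]=0 ,$$ where the time integral and the expectation are those of integrable functions. -/

import Mathlib

open MeasureTheory Filter Topology Set
open scoped unitInterval NNReal

noncomputable section

/-- A simple graph on the vertex set `V` together with a colouring of the vertices by two colours;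
`true` is colour `1` (white), `false` is colour `0` (black). -/
@[ext]
structure ColouredGraph (V : Type*) where
  graph : SimpleGraph V
  colour : V → Bool

namespace ColouredGraph

instance {V : Type*} [Finite V] : Finite (ColouredGraph V) :=
  Finite.of_injective (fun G : ColouredGraph V => (G.graph, G.colour)) (by
    intro G H h
    have h' := Prod.mk.inj h
    exact ColouredGraph.ext h'.1 h'.2)

instance {V : Type*} [Finite V] : Fintype (ColouredGraph V) := Fintype.ofFinite _

instance {V : Type*} : DecidableEq (ColouredGraph V) := Classical.decEq _

/-- Isomorphism of coloured graphs. -/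
def Isomorphic {V W : Type*} (G : ColouredGraph V) (H : ColouredGraph W) : Prop :=
  ∃ e : V ≃ W, (∀ u v, H.graph.Adj (e u) (e v) ↔ G.graph.Adj u v) ∧
    ∀ u, H.colour (e u) = G.colour u

/-- `G^u`: the colour of the vertex `u` is flipped. -/
def flipColour {V : Type*} [DecidableEq V] (G : ColouredGraph V) (u : V) : ColouredGraph V where
  graph := G.graph
  colour := Function.update G.colour u (!(G.colour u))

/-- `G^{uv}`: the status of the edge between the distinct vertices `u` and `v` is switched. -/
def flipEdge {V : Type*} (G : ColouredGraph V) (u v : V) : ColouredGraph V where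
  graph := symmDiff G.graph (SimpleGraph.edge u v)
  colour := G.colour

end ColouredGraph

/-! ### The co-evolving dynamics -/

/-- The six parameters of the model: the speeds `η` and `ρ` of the vertex and edge updates, and the
switching rates of edges (`c`: concordant end points, `d`: discordant end points; `0`: the edge is
absent, `1`: the edge is present). -/
structure VoterParams where
  η : ℝ
  ρ : ℝ
  sc0 : ℝ
  sc1 : ℝ
  sd0 : ℝ
  sd1 : ℝ

open Classical in
/-- The number of neighbours of `u` whose colour differs from that of `u`. -/
def vertexRate {n : ℕ} (G : ColouredGraph (Fin n)) (u : Fin n) : ℝ :=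
  ∑ v : Fin n, if G.graph.Adj u v ∧ G.colour u ≠ G.colour v then 1 else 0

open Classical in
/-- The rate (up to the factor `ρ`) at which the edge between `u` and `v` is switched. -/
def edgeRate (θ : VoterParams) {n : ℕ} (G : ColouredGraph (Fin n)) (u v : Fin n) : ℝ :=
  if G.colour u = G.colour v then
    (if G.graph.Adj u v then θ.sc1 else θ.sc0)
  else
    (if G.graph.Adj u v then θ.sd1 else θ.sd0)

/-- The generator of the coloured graph process on `n` vertices. -/
def generator (θ : VoterParams) (n : ℕ) :
    (ColouredGraph (Fin n) → ℝ) →ₗ[ℝ] (ColouredGraph (Fin n) → ℝ) where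
  toFun f G :=
    θ.η * ∑ u : Fin n, vertexRate G u * (f (G.flipColour u) - f G) +
    θ.ρ * ∑ e : Fin n × Fin n with e.1 < e.2,
      edgeRate θ G e.1 e.2 * (f (G.flipEdge e.1 e.2) - f G)
  map_add' f g := by
    funext G
    simp only [Pi.add_apply, add_sub_add_comm, mul_add, Finset.sum_add_distrib]
    ring
  map_smul' a f := by
    funext G
    simp only [Pi.smul_apply, smul_eq_mul, RingHom.id_apply, ← mul_sub, mul_left_comm _ a,
      ← Finset.mul_sum, ← mul_add]

/-- The transition matrix `exp (t A)` at time `t` of the continuous-time Markov chain with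
generator `A` on a finite state space. -/
def transition {S : Type*} [Fintype S] [DecidableEq S] (A : (S → ℝ) →ₗ[ℝ] (S → ℝ)) (t : ℝ) :
    Matrix S S ℝ :=
  NormedSpace.exp (t • LinearMap.toMatrix' A)

/-- `X` is a continuous-time Markov chain with generator `A` on the finite state space `S`, with
right-continuous paths (for the discrete topology on `S`) and arbitrary initial law. -/
structure IsMarkovChain {S : Type*} [Fintype S] [DecidableEq S] (A : (S → ℝ) →ₗ[ℝ] (S → ℝ))
    {Ω : Type*} [MeasurableSpace Ω] (P : Measure Ω) (X : ℝ≥0 → Ω → S) : Prop where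
  measurableSet_eq : ∀ t x, MeasurableSet {ω | X t ω = x}
  right_continuous : ∀ ω t, ∀ᶠ s in 𝓝[≥] t, X s ω = X t ω
  markov : ∀ (k : ℕ) (t : Fin (k + 1) → ℝ≥0), Monotone t → ∀ x : Fin (k + 1) → S,
    P.real {ω | ∀ i, X (t i) ω = x i} =
      P.real {ω | X (t 0) ω = x 0} *
        ∏ i : Fin k, transition A ((t i.succ : ℝ) - t i.castSucc) (x i.castSucc) (x i.succ)

/-! ### Coloured graphons -/

/-- A coloured graphon: a symmetric measurable `κ : [0,1]² → [0,1]` and a measurable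
`c : [0,1] → [0,1]`. -/
structure ColouredGraphon where
  κ : I → I → ℝ
  c : I → ℝ
  κ_measurable : Measurable fun p : I × I => κ p.1 p.2
  κ_symm : ∀ x y, κ x y = κ y x
  κ_mem : ∀ x y, κ x y ∈ Icc (0 : ℝ) 1
  c_measurable : Measurable c
  c_mem : ∀ x, c x ∈ Icc (0 : ℝ) 1

namespace ColouredGraphon

/-- The average colour. -/
def meanColour (W : ColouredGraphon) : ℝ := ∫ x, W.c x

/-- The projection onto the coloured graphons with constant colour function: the graphon is kept
and the colour function is replaced by its average. -/
def proj (W : ColouredGraphon) : ColouredGraphon where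
  κ := W.κ
  c := fun _ => W.meanColour
  κ_measurable := W.κ_measurable
  κ_symm := W.κ_symm
  κ_mem := W.κ_mem
  c_measurable := measurable_const
  c_mem := fun _ => by
    refine ⟨integral_nonneg fun x => (W.c_mem x).1, ?_⟩
    have h := integral_mono_of_nonneg (μ := (volume : Measure I)) (f := W.c) (g := fun _ => 1)
      (Eventually.of_forall fun x => (W.c_mem x).1) (integrable_const _)
      (Eventually.of_forall fun x => (W.c_mem x).2)
    simpa [meanColour] using h

/-- The connectedness `inf_{x,y} ∫ κ(x,z) κ(z,y) dz`. -/
def connectedness (W : ColouredGraphon) : ℝ := ⨅ p : I × I, ∫ z, W.κ p.1 z * W.κ z p.2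

open Classical in
/-- The coloured subgraph density `t_F(κ,c)`. -/
def density {m : ℕ} (F : ColouredGraph (Fin m)) (W : ColouredGraphon) : ℝ :=
  ∫ x : Fin m → I,
    (∏ e : Fin m × Fin m with e.1 < e.2 ∧ F.graph.Adj e.1 e.2, W.κ (x e.1) (x e.2)) *
      ∏ i, if F.colour i then W.c (x i) else 1 - W.c (x i)

end ColouredGraphon

/-- `F` lists every isomorphism class of (non-empty) finite coloured graphs exactly once; the
graph `F i` has vertex set `Fin ((F i).1 + 1)`. -/
def IsEnumeration (F : ℕ → Σ k : ℕ, ColouredGraph (Fin (k + 1))) : Prop :=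
  ∀ (k : ℕ) (H : ColouredGraph (Fin (k + 1))), ∃! i, H.Isomorphic (F i).2

/-- The coloured subgraph distance associated with the enumeration `F`. -/
def dsub (F : ℕ → Σ k : ℕ, ColouredGraph (Fin (k + 1))) (W W' : ColouredGraphon) : ℝ :=
  ∑' i, (2 : ℝ)⁻¹ ^ (i + 1) * |W.density (F i).2 - W'.density (F i).2|

/-- `i` (numbered from `0`) is the vertex with label `⌈n x⌉` in the numbering from `1`;
the point `x = 0` belongs to the first vertex. -/
def IsCell (n : ℕ) (x : I) (i : Fin n) : Prop := (i : ℕ) + 1 = max ⌈(n : ℝ) * x⌉₊ 1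

open Classical in
/-- The coloured graphon that represents a coloured graph on `n` vertices: the empirical graphon
and the empirical colouring. -/
def ColouredGraph.toGraphon {n : ℕ} (G : ColouredGraph (Fin n)) : ColouredGraphon where
  κ x y := if ∃ i j, IsCell n x i ∧ IsCell n y j ∧ G.graph.Adj i j then 1 else 0
  c x := if ∃ i, IsCell n x i ∧ G.colour i = true then 1 else 0
  κ_measurable := by
    have h : Measurable fun p : I × I => (⌈(n : ℝ) * p.1⌉₊, ⌈(n : ℝ) * p.2⌉₊) := by
      refine Measurable.prodMk (Nat.measurable_ceil.comp ?_) (Nat.measurable_ceil.comp ?_) <;>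
        fun_prop
    have h' : Measurable fun q : ℕ × ℕ =>
        if ∃ i j : Fin n, (i : ℕ) + 1 = max q.1 1 ∧ (j : ℕ) + 1 = max q.2 1 ∧ G.graph.Adj i j
          then (1 : ℝ) else 0 := measurable_of_countable _
    convert h'.comp h using 1
    funext
    simp only [IsCell, Function.comp_apply]
    congr
  κ_symm x y := by
    congr 1
    refine propext ⟨?_, ?_⟩ <;>
      · rintro ⟨i, j, hi, hj, hij⟩
        exact ⟨j, i, hj, hi, hij.symm⟩
  κ_mem x y := by split_ifs <;> simp
  c_measurable := by
    have h : Measurable fun x : I => ⌈(n : ℝ) * x⌉₊ := Nat.measurable_ceil.comp (by fun_prop)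
    have h' : Measurable fun q : ℕ =>
        if ∃ i : Fin n, (i : ℕ) + 1 = max q 1 ∧ G.colour i = true then (1 : ℝ) else 0 :=
      measurable_of_countable _
    convert h'.comp h using 1
    funext
    simp only [IsCell, Function.comp_apply]
    congr
  c_mem x := by split_ifs <;> simp

/-! ### The path distance -/

/-- The integrand of the path distance at time `t ≥ 0`, for a state space `E` with
(pseudo-)distance `r`. -/
def pathIntegrand {E : Type*} (r : E → E → ℝ) (x y : ℝ≥0 → E) (t : ℝ) : ℝ :=
  min 1 (r (x t.toNNReal) (y t.toNNReal)) * Real.exp (-t)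

/-- The distance `∫₀^∞ (1 ∧ r(x_t, y_t)) e^{-t} dt` that induces the path topology of convergence
in measure. -/
def dpath {E : Type*} (r : E → E → ℝ) (x y : ℝ≥0 → E) : ℝ :=
  ∫ t in Ioi (0 : ℝ), pathIntegrand r x y t

end

/-! Two time scales separate: a colour flips at a rate of order `n`, an edge switches at a rate of
order one. In a window of length `ε = n^(-3/4)` before a fixed time `t > 0` only a fraction of order
`ε` of the edges moves, while the random walk on the graph, the linear dual of the colour dynamics,
mixes because `n ε → ∞`. At the end of the window the colours are therefore nearly uncorrelated with
the graph at its start, and hence with the graph at its end.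

Quantitatively (`transition_sq_sum_col_le`), take a weight `φ` of zero sum, fixed by the graph `h`
at the start. Transport `φ` backwards by the heat flow of `h` and pair it with the current colours.
The drift of the squared pairing consists of a noise term of order one and an error from the edges
that have moved, so the window contributes order `ε + n ε²`. The initial value decays like `exp (-c
n ε)` by a Poincaré inequality (`WellConnected.poincare`), valid when any two vertices have order
`n` common neighbours. That property survives up to time `t` with overwhelming probability: an
exponential functional of the number of common neighbours is controlled by a supermartingale
(`transition_pow_card_commonNbrs_le`), followed by Chernoff and union bounds
(`transition_not_wellConnected_le`).

A subgraph density changes under the projection by a telescoping sum that replaces the colours one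
at a time by their mean (`abs_density_sub_density_proj_le`). Each term is an average of centred
linear functionals of the colours, to which the decorrelation estimate applies. The Markov property
at `t - ε` joins the two estimates (`transition_densityDefect_le`); dominated convergence then
handles the series over test graphs and the time integral. -/

/-- A generator of a continuous-time Markov chain on a finite state space, characterised by the
positive minimum principle. -/
structure IsMarkovGenerator {S : Type*} (A : (S → ℝ) →ₗ[ℝ] (S → ℝ)) : Prop where
  map_one : A 1 = 0
  nonneg : ∀ f x, 0 ≤ f → f x = 0 → 0 ≤ A f x

/-! ### Semigroups of finite Markov chains: Kolmogorov equation, positivity, moment bounds. -/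

section Semigroup

open Matrix

variable {S : Type*} [Fintype S] [DecidableEq S]

attribute [local instance] Matrix.linftyOpNormedAddCommGroup Matrix.linftyOpNormedRing
  Matrix.linftyOpNormedAlgebra Matrix.linftyOpNormedSpace

theorem toMatrix'_mulVec_eq (A : (S → ℝ) →ₗ[ℝ] (S → ℝ)) (f : S → ℝ) :
    LinearMap.toMatrix' A *ᵥ f = A f := by
  rw [← Matrix.toLin'_apply, Matrix.toLin'_toMatrix']

theorem transition_zero (A : (S → ℝ) →ₗ[ℝ] (S → ℝ)) : transition A 0 = 1 := by
  simp [transition]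

theorem transition_add (A : (S → ℝ) →ₗ[ℝ] (S → ℝ)) (s t : ℝ) :
    transition A (s + t) = transition A s * transition A t := by
  rw [transition, add_smul, Matrix.exp_add_of_commute]
  · rfl
  · exact ((Commute.refl _).smul_left _).smul_right _

theorem hasDerivAt_transition (A : (S → ℝ) →ₗ[ℝ] (S → ℝ)) (t : ℝ) :
    HasDerivAt (transition A) (transition A t * LinearMap.toMatrix' A) t :=
  hasDerivAt_exp_smul_const (𝕂 := ℝ) (LinearMap.toMatrix' A) t

theorem commute_transition (A : (S → ℝ) →ₗ[ℝ] (S → ℝ)) (t : ℝ) :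
    transition A t * LinearMap.toMatrix' A = LinearMap.toMatrix' A * transition A t :=
  (((Commute.refl (LinearMap.toMatrix' A)).smul_right t).exp_right).symm

theorem transition_mulVec_map (A : (S → ℝ) →ₗ[ℝ] (S → ℝ)) (t : ℝ) (f : S → ℝ) :
    transition A t *ᵥ A f = A (transition A t *ᵥ f) := by
  rw [← toMatrix'_mulVec_eq A f, ← toMatrix'_mulVec_eq, mulVec_mulVec, mulVec_mulVec,
    commute_transition]

/-- Kolmogorov's equation with the generator applied to the observable, so that a pointwise bound on
`A (F t) + F'` yields a bound on the expectation by positivity alone. -/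
theorem hasDerivAt_transition_mulVec (A : (S → ℝ) →ₗ[ℝ] (S → ℝ)) {F : ℝ → S → ℝ} {F' : S → ℝ}
    {t : ℝ} (hF : ∀ x, HasDerivAt (fun r => F r x) (F' x) t) (x : S) :
    HasDerivAt (fun r => (transition A r *ᵥ F r) x) ((transition A t *ᵥ (A (F t) + F')) x) t := by
  have h1 : ∀ y, HasDerivAt (fun r => transition A r x y)
      ((transition A t * LinearMap.toMatrix' A) x y) t := fun y => by
    have := hasDerivAt_pi.1 (hasDerivAt_pi.1 (hasDerivAt_transition A t) x) y
    exact this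
  have h2 := HasDerivAt.fun_sum (u := Finset.univ) fun y _ => (h1 y).mul (hF y)
  refine h2.congr_deriv ?_
  rw [mulVec_add, ← toMatrix'_mulVec_eq A (F t), mulVec_mulVec, Finset.sum_add_distrib]
  rfl

theorem transition_mulVec_one {A : (S → ℝ) →ₗ[ℝ] (S → ℝ)} (hA : IsMarkovGenerator A) (t : ℝ) :
    transition A t *ᵥ 1 = 1 := by
  funext x
  have h : ∀ r, HasDerivAt (fun r => (transition A r *ᵥ (1 : S → ℝ)) x) 0 r := fun r => by
    have := hasDerivAt_transition_mulVec A (F := fun _ => 1) (F' := 0) (t := r)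
      (fun y => hasDerivAt_const _ _) x
    simpa [hA.map_one] using this
  have := is_const_of_deriv_eq_zero (fun r => (h r).differentiableAt) (fun r => (h r).deriv) t 0
  simpa [transition_zero] using this

theorem exp_apply_nonneg {M : Matrix S S ℝ} (hM : ∀ x y, 0 ≤ M x y) (x y : S) :
    0 ≤ NormedSpace.exp M x y := by
  have hpow : ∀ k : ℕ, ∀ x y, 0 ≤ (M ^ k) x y := by
    intro k
    induction k with
    | zero => intro x y; simp only [pow_zero, one_apply]; split_ifs <;> simp
    | succ k ih =>
      intro x y
      rw [pow_succ, mul_apply]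
      exact Finset.sum_nonneg fun z _ => mul_nonneg (ih _ _) (hM _ _)
  have h := NormedSpace.exp_series_hasSum_exp' (𝕂 := ℝ) M
  have h' := Pi.hasSum.1 (Pi.hasSum.1 h x) y
  refine h'.nonneg fun k => ?_
  simp only [Matrix.smul_apply, smul_eq_mul]
  exact mul_nonneg (by positivity) (hpow _ _ _)

theorem transition_apply_nonneg {A : (S → ℝ) →ₗ[ℝ] (S → ℝ)} (hA : IsMarkovGenerator A) {t : ℝ}
    (ht : 0 ≤ t) (x y : S) : 0 ≤ transition A t x y := by
  set M := LinearMap.toMatrix' A with hM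
  -- Shifting by `c` times the identity makes every entry nonnegative and changes the exponential
  -- only by the positive factor `exp (-(t * c))`.
  set c : ℝ := ∑ z, |M z z| with hc
  have hoff : ∀ x y, x ≠ y → 0 ≤ M x y := fun x y hxy => by
    rw [hM, LinearMap.toMatrix'_apply]
    refine hA.nonneg _ _ (fun z => ?_) ?_
    · exact (Pi.single_nonneg.2 zero_le_one : (0 : S → ℝ) ≤ Pi.single y 1) z
    · simp [hxy]
  have hpos : ∀ x y, 0 ≤ (t • (M + c • 1)) x y := fun x y => by
    simp only [Matrix.smul_apply, Matrix.add_apply, smul_eq_mul, Matrix.one_apply]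
    refine mul_nonneg ht ?_
    split_ifs with hxy
    · subst hxy
      have : |M x x| ≤ c := Finset.single_le_sum (f := fun z => |M z z|)
        (fun z _ => abs_nonneg _) (Finset.mem_univ x)
      have := neg_abs_le (M x x)
      linarith
    · simpa using hoff x y hxy
  have hdec : t • M = t • (M + c • 1) + (-(t * c)) • (1 : Matrix S S ℝ) := by
    rw [smul_add, smul_smul, add_assoc, ← add_smul]; simp
  rw [transition, hdec, Matrix.exp_add_of_commute _ _ ((Commute.one_right _).smul_right _)]
  have h1 : NormedSpace.exp ((-(t * c)) • (1 : Matrix S S ℝ)) = Real.exp (-(t * c)) • 1 := by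
    rw [← Algebra.algebraMap_eq_smul_one, ← Algebra.algebraMap_eq_smul_one,
      Real.exp_eq_exp_ℝ]
    exact (NormedSpace.algebraMap_exp_comm _).symm
  rw [h1, mul_smul_comm, mul_one, Matrix.smul_apply, smul_eq_mul]
  exact mul_nonneg (Real.exp_nonneg _) (exp_apply_nonneg hpos x y)

theorem transition_mulVec_mono {A : (S → ℝ) →ₗ[ℝ] (S → ℝ)} (hA : IsMarkovGenerator A) {t : ℝ}
    (ht : 0 ≤ t) {f g : S → ℝ} (h : ∀ y, f y ≤ g y) (x : S) :
    (transition A t *ᵥ f) x ≤ (transition A t *ᵥ g) x :=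
  Finset.sum_le_sum fun y _ => mul_le_mul_of_nonneg_left (h y) (transition_apply_nonneg hA ht x y)

theorem transition_mulVec_const {A : (S → ℝ) →ₗ[ℝ] (S → ℝ)} (hA : IsMarkovGenerator A) (t c : ℝ)
    (x : S) : (transition A t *ᵥ fun _ => c) x = c := by
  have h : (fun _ : S => c) = c • 1 := by ext; simp
  rw [h, mulVec_smul, transition_mulVec_one hA]; simp

theorem transition_mulVec_le {A : (S → ℝ) →ₗ[ℝ] (S → ℝ)} (hA : IsMarkovGenerator A) {t : ℝ}
    (ht : 0 ≤ t) {f : S → ℝ} {c : ℝ} (h : ∀ y, f y ≤ c) (x : S) :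
    (transition A t *ᵥ f) x ≤ c :=
  (transition_mulVec_mono hA ht h x).trans_eq (transition_mulVec_const hA t c x)

theorem le_transition_mulVec {A : (S → ℝ) →ₗ[ℝ] (S → ℝ)} (hA : IsMarkovGenerator A) {t : ℝ}
    (ht : 0 ≤ t) {f : S → ℝ} {c : ℝ} (h : ∀ y, c ≤ f y) (x : S) :
    c ≤ (transition A t *ᵥ f) x :=
  (transition_mulVec_const hA t c x).symm.trans_le (transition_mulVec_mono hA ht h x)

/-- Integrated form of the Kolmogorov equation for a time-dependent observable, as an
inequality. -/
theorem transition_mulVec_le_of_deriv_le {A : (S → ℝ) →ₗ[ℝ] (S → ℝ)} {F F' : ℝ → S → ℝ}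
    (hF : ∀ r x, HasDerivAt (fun r => F r x) (F' r x) r) {B B' : ℝ → ℝ}
    (hB : ∀ r, HasDerivAt B (B' r) r) {T : ℝ} (hT : 0 ≤ T) (x : S)
    (h : ∀ r, 0 ≤ r → r ≤ T → (transition A r *ᵥ (A (F r) + F' r)) x ≤ B' r) :
    (transition A T *ᵥ F T) x ≤ F 0 x + (B T - B 0) := by
  have hd : ∀ r, HasDerivAt (fun r => B r - (transition A r *ᵥ F r) x)
      (B' r - (transition A r *ᵥ (A (F r) + F' r)) x) r := fun r =>
    (hB r).sub (hasDerivAt_transition_mulVec A (hF r) x)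
  have hm : MonotoneOn (fun r => B r - (transition A r *ᵥ F r) x) (Icc 0 T) := by
    refine monotoneOn_of_deriv_nonneg (convex_Icc 0 T)
      (fun r _ => (hd r).continuousAt.continuousWithinAt)
      (fun r _ => (hd r).differentiableAt.differentiableWithinAt) fun r hr => ?_
    rw [interior_Icc] at hr
    rw [(hd r).deriv]
    exact sub_nonneg.2 (h r hr.1.le hr.2.le)
  have := hm (left_mem_Icc.2 hT) (right_mem_Icc.2 hT) hT
  simp only [transition_zero, one_mulVec] at this
  linarith

/-- Jensen's inequality, obtained from the pointwise AM-GM bound `|f| ≤ √ω / 2 + f² / (2 √ω)`;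
dividing by `√ω` is why `ω` is positive. -/
theorem transition_mulVec_abs_le_sqrt {A : (S → ℝ) →ₗ[ℝ] (S → ℝ)} (hA : IsMarkovGenerator A)
    {t : ℝ} (ht : 0 ≤ t) {f : S → ℝ} {ω : ℝ} (hω : 0 < ω) {x : S}
    (h : (transition A t *ᵥ fun y => f y ^ 2) x ≤ ω) :
    (transition A t *ᵥ fun y => |f y|) x ≤ √ω := by
  have hs : 0 < √ω := Real.sqrt_pos.2 hω
  have h1 : ∀ y, |f y| ≤ (√ω / 2) + (1 / (2 * √ω)) * f y ^ 2 := fun y => by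
    have : 0 ≤ (|f y| - √ω) ^ 2 / (2 * √ω) := by positivity
    have e : (|f y| - √ω) ^ 2 / (2 * √ω) = (√ω / 2) + (1 / (2 * √ω)) * f y ^ 2 - |f y| := by
      rw [sub_sq, sq_abs]; field_simp; ring
    linarith
  have h2 := transition_mulVec_mono hA ht h1 x
  have e : (fun y => (√ω / 2) + (1 / (2 * √ω)) * f y ^ 2) =
      (fun _ => √ω / 2) + (1 / (2 * √ω)) • fun y => f y ^ 2 := by ext; simp
  rw [e, mulVec_add, mulVec_smul, Pi.add_apply, Pi.smul_apply, smul_eq_mul,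
    transition_mulVec_const hA] at h2
  have h3 : 1 / (2 * √ω) * (transition A t *ᵥ fun y => f y ^ 2) x ≤ 1 / (2 * √ω) * ω := by gcongr
  have h4 : 1 / (2 * √ω) * ω = √ω / 2 := by
    nth_rewrite 2 [← Real.mul_self_sqrt hω.le]; field_simp
  linarith

end Semigroup

/-! ### Rates of the coloured graph process and movement of its edges. -/

section GraphProcess

open scoped Matrix

namespace VoterParams

/-- The parameters are admissible: positive speeds and non-negative switching rates. -/
structure Admissible (θ : VoterParams) : Prop where
  η_pos : 0 < θ.η
  ρ_pos : 0 < θ.ρ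
  sc0_nonneg : 0 ≤ θ.sc0
  sc1_nonneg : 0 ≤ θ.sc1
  sd0_nonneg : 0 ≤ θ.sd0
  sd1_nonneg : 0 ≤ θ.sd1

/-- An upper bound for the rate at which a given edge is switched. -/
noncomputable def edgeBound (θ : VoterParams) : ℝ := θ.ρ * (θ.sc0 + θ.sc1 + θ.sd0 + θ.sd1)

theorem Admissible.edgeBound_nonneg {θ : VoterParams} (hθ : θ.Admissible) : 0 ≤ θ.edgeBound := by
  have := hθ.ρ_pos; have := hθ.sc0_nonneg; have := hθ.sc1_nonneg
  have := hθ.sd0_nonneg; have := hθ.sd1_nonneg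
  unfold edgeBound; positivity

end VoterParams

namespace ColouredGraph

open Classical in
/-- The entries of the adjacency matrix. -/
noncomputable def adj {V : Type*} (G : ColouredGraph V) (u v : V) : ℝ := if G.graph.Adj u v then 1 else 0

/-- The colour of a vertex as a real number. -/
noncomputable def col {V : Type*} (G : ColouredGraph V) (u : V) : ℝ := if G.colour u then 1 else 0

variable {V : Type*} (G H : ColouredGraph V) (u v : V)

theorem adj_comm : G.adj u v = G.adj v u := by
  unfold adj; congr 1; exact propext (G.graph.adj_comm u v)

theorem adj_nonneg : 0 ≤ G.adj u v := by unfold adj; split_ifs <;> simp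

theorem adj_le_one : G.adj u v ≤ 1 := by unfold adj; split_ifs <;> simp

theorem abs_adj_sub_le : |G.adj u v - H.adj u v| ≤ 1 := by
  unfold adj; split_ifs <;> simp

theorem col_nonneg : 0 ≤ G.col u := by unfold col; split_ifs <;> simp

theorem col_le_one : G.col u ≤ 1 := by unfold col; split_ifs <;> simp

theorem abs_col_sub_col_le : |G.col u - G.col v| ≤ 1 := by
  unfold col; split_ifs <;> simp

@[simp]
theorem adj_flipColour [DecidableEq V] (w : V) : (G.flipColour w).adj u v = G.adj u v := rfl

theorem col_flipColour [DecidableEq V] (w : V) :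
    (G.flipColour u).col w = G.col w + if w = u then 1 - 2 * G.col u else 0 := by
  by_cases h : w = u
  · subst h
    cases h : G.colour w <;> simp [col, flipColour, h]; norm_num
  · simp [col, flipColour, h]

theorem flipEdge_adj_iff (a b : V) :
    (G.flipEdge a b).graph.Adj u v ↔ Xor (G.graph.Adj u v) (s(a, b) = s(u, v) ∧ u ≠ v) := by
  simp only [flipEdge, symmDiff, SimpleGraph.sup_adj, SimpleGraph.sdiff_adj,
    SimpleGraph.edge_adj, Xor, Sym2.eq_iff]
  tauto

theorem flipEdge_adj_of_ne {a b : V} (h : s(a, b) ≠ s(u, v)) :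
    (G.flipEdge a b).graph.Adj u v ↔ G.graph.Adj u v := by
  rw [flipEdge_adj_iff]; simp [h, Xor]

/-- A switch of `{a, b}` touches only the ordered entries `(a, b)` and `(b, a)`. The nested
conditionals let the double sum be evaluated one index at a time. -/
theorem abs_adj_flipEdge_sub_le [DecidableEq V] (a b : V) :
    |(G.flipEdge a b).adj u v - H.adj u v| ≤
      |G.adj u v - H.adj u v| + ((if u = a then if v = b then 1 else 0 else 0) +
        (if u = b then if v = a then 1 else 0 else 0)) := by
  by_cases h : s(a, b) = s(u, v)
  · have h1 : (1 : ℝ) ≤ (if u = a then if v = b then 1 else 0 else 0) +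
        (if u = b then if v = a then 1 else 0 else 0) := by
      rcases Sym2.eq_iff.1 h with ⟨rfl, rfl⟩ | ⟨rfl, rfl⟩
      · simp only [if_true]; split_ifs <;> norm_num
      · simp only [if_true]; split_ifs <;> norm_num
    have := abs_adj_sub_le (G.flipEdge a b) H u v
    have := abs_nonneg (G.adj u v - H.adj u v)
    linarith
  · have e : (G.flipEdge a b).adj u v = G.adj u v := by
      unfold adj; congr 1; exact propext (flipEdge_adj_of_ne G u v h)
    rw [e]
    have : (0 : ℝ) ≤ (if u = a then if v = b then 1 else 0 else 0) +
        (if u = b then if v = a then 1 else 0 else 0) := by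
      split_ifs <;> norm_num
    linarith

/-- The number of ordered pairs of vertices at which two graphs differ. -/
noncomputable def edgeDiff [Fintype V] (H G : ColouredGraph V) : ℝ := ∑ u, ∑ v, |G.adj u v - H.adj u v|

theorem edgeDiff_self [Fintype V] : edgeDiff G G = 0 := by simp [edgeDiff]

theorem edgeDiff_nonneg [Fintype V] : 0 ≤ edgeDiff H G :=
  Finset.sum_nonneg fun _ _ => Finset.sum_nonneg fun _ _ => abs_nonneg _

theorem edgeDiff_flipEdge_le [Fintype V] [DecidableEq V] (a b : V) :
    edgeDiff H (G.flipEdge a b) ≤ edgeDiff H G + 2 := by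
  have h := Finset.sum_le_sum fun u (_ : u ∈ (Finset.univ : Finset V)) =>
    Finset.sum_le_sum fun v (_ : v ∈ (Finset.univ : Finset V)) =>
      abs_adj_flipEdge_sub_le G H u v a b
  refine h.trans_eq ?_
  simp only [Finset.sum_add_distrib, edgeDiff, add_right_inj]
  have h2 : ∀ x y : V, (∑ u : V, ∑ v : V, if u = x then if v = y then (1 : ℝ) else 0 else 0) = 1 := by
    intro x y
    rw [Finset.sum_eq_single x (fun u _ hu => by simp [hu]) (by simp)]
    simp
  rw [h2, h2]; norm_num

end ColouredGraph

open ColouredGraph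

variable {θ : VoterParams} {n : ℕ}

/-- A flip at `u` changes its colour value by `1 - 2 * G.col u`, which equals `G.col v - G.col u` at
each neighbour of opposite colour, and neighbours of equal colour contribute zero. Hence the
expected drift of the colours is the graph Laplacian: this is the duality with the random walk. -/
theorem vertexRate_eq (G : ColouredGraph (Fin n)) (u : Fin n) :
    vertexRate G u * (1 - 2 * G.col u) = ∑ v, G.adj u v * (G.col v - G.col u) := by
  rw [vertexRate, Finset.sum_mul]
  refine Finset.sum_congr rfl fun v _ => ?_
  by_cases h : G.graph.Adj u v <;> cases hu : G.colour u <;> cases hv : G.colour v <;>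
    simp [adj, col, h, hu, hv]; norm_num

theorem vertexRate_nonneg (G : ColouredGraph (Fin n)) (u : Fin n) : 0 ≤ vertexRate G u :=
  Finset.sum_nonneg fun v _ => by split_ifs <;> simp

theorem vertexRate_le (G : ColouredGraph (Fin n)) (u : Fin n) : vertexRate G u ≤ n := by
  refine (Finset.sum_le_sum (g := fun _ => (1 : ℝ)) fun v _ => ?_).trans_eq (by simp)
  split_ifs <;> simp

theorem edgeRate_nonneg (hθ : θ.Admissible) (G : ColouredGraph (Fin n)) (u v : Fin n) :
    0 ≤ edgeRate θ G u v := by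
  unfold edgeRate
  split_ifs
  exacts [hθ.sc1_nonneg, hθ.sc0_nonneg, hθ.sd1_nonneg, hθ.sd0_nonneg]

theorem mul_edgeRate_le (hθ : θ.Admissible) (G : ColouredGraph (Fin n)) (u v : Fin n) :
    θ.ρ * edgeRate θ G u v ≤ θ.edgeBound := by
  have := hθ.sc0_nonneg; have := hθ.sc1_nonneg
  have := hθ.sd0_nonneg; have := hθ.sd1_nonneg
  refine mul_le_mul_of_nonneg_left ?_ hθ.ρ_pos.le
  unfold edgeRate
  split_ifs <;> linarith

theorem generator_apply (f : ColouredGraph (Fin n) → ℝ) (G : ColouredGraph (Fin n)) :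
    generator θ n f G = θ.η * ∑ u : Fin n, vertexRate G u * (f (G.flipColour u) - f G) +
    ∑ e : Fin n × Fin n with e.1 < e.2,
      θ.ρ * edgeRate θ G e.1 e.2 * (f (G.flipEdge e.1 e.2) - f G) := by
  simp only [mul_assoc, ← Finset.mul_sum]
  rfl

theorem isMarkovGenerator_generator (hθ : θ.Admissible) (n : ℕ) :
    IsMarkovGenerator (generator θ n) where
  map_one := by ext G; simp [generator_apply]
  nonneg f G hf hG := by
    rw [generator_apply]
    have := hθ.ρ_pos.le
    refine add_nonneg (mul_nonneg hθ.η_pos.le (Finset.sum_nonneg fun u _ => ?_))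
      (Finset.sum_nonneg fun e _ => ?_)
    · rw [hG, sub_zero]; exact mul_nonneg (vertexRate_nonneg _ _) (hf _)
    · rw [hG, sub_zero]
      exact mul_nonneg (mul_nonneg this (edgeRate_nonneg hθ _ _ _)) (hf _)

/-- If no edge switch increases `f` by more than `c`, and `f` does not depend on the colours. -/
theorem generator_apply_le_of_graph (hθ : θ.Admissible) {f : ColouredGraph (Fin n) → ℝ}
    {G : ColouredGraph (Fin n)} (hf : ∀ u, f (G.flipColour u) = f G)
    (c : Fin n × Fin n → ℝ) (hc : ∀ e, 0 ≤ c e)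
    (h : ∀ e : Fin n × Fin n, e.1 < e.2 → f (G.flipEdge e.1 e.2) - f G ≤ c e) :
    generator θ n f G ≤ θ.edgeBound * ∑ e : Fin n × Fin n with e.1 < e.2, c e := by
  rw [generator_apply]
  simp only [hf, sub_self, mul_zero, Finset.sum_const_zero, zero_add]
  rw [Finset.mul_sum]
  refine Finset.sum_le_sum fun e he => ?_
  have he' := (Finset.mem_filter.1 he).2
  calc _ ≤ θ.ρ * edgeRate θ G e.1 e.2 * c e :=
        mul_le_mul_of_nonneg_left (h e he') (mul_nonneg hθ.ρ_pos.le (edgeRate_nonneg hθ _ _ _))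
    _ ≤ _ := mul_le_mul_of_nonneg_right (mul_edgeRate_le hθ _ _ _) (hc e)

/-- At most `n ^ 2` pairs switch, each at rate at most `θ.edgeBound`, and each switch adds at most
two differing ordered entries. -/
theorem transition_edgeDiff_le (hθ : θ.Admissible) (h : ColouredGraph (Fin n)) {t : ℝ}
    (ht : 0 ≤ t) :
    (transition (generator θ n) t *ᵥ edgeDiff h) h ≤ 2 * θ.edgeBound * n ^ 2 * t := by
  have hA := isMarkovGenerator_generator hθ n
  have key := transition_mulVec_le_of_deriv_le (A := generator θ n) (F := fun _ => edgeDiff h)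
    (F' := fun _ _ => 0) (fun r x => hasDerivAt_const _ _)
    (B := fun r => 2 * θ.edgeBound * n ^ 2 * r) (B' := fun _ => 2 * θ.edgeBound * n ^ 2)
    (fun r => by simpa using (hasDerivAt_id r).const_mul (2 * θ.edgeBound * n ^ 2)) ht h
    fun r hr _ => ?_
  · simpa [edgeDiff_self] using key
  · refine transition_mulVec_le hA hr (fun G => ?_) h
    simp only [Pi.add_apply, add_zero]
    refine (generator_apply_le_of_graph hθ (fun u => by simp [edgeDiff]) (fun _ => 2)
      (fun _ => zero_le_two) fun e _ => ?_).trans ?_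
    · linarith [edgeDiff_flipEdge_le G h e.1 e.2]
    · have hcard : ((Finset.univ.filter fun e : Fin n × Fin n => e.1 < e.2).card : ℝ) ≤ n ^ 2 := by
        have := Finset.card_filter_le (Finset.univ : Finset (Fin n × Fin n)) fun e => e.1 < e.2
        simp only [Finset.card_univ, Fintype.card_prod, Fintype.card_fin] at this
        calc _ ≤ ((n * n : ℕ) : ℝ) := Nat.cast_le.2 this
          _ = _ := by push_cast; ring
      rw [Finset.sum_const, nsmul_eq_mul]
      have := mul_le_mul_of_nonneg_left hcard hθ.edgeBound_nonneg
      linarith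

/-! ### Common neighbours -/

open Classical in
/-- The set of common neighbours of two vertices. -/
noncomputable def commonNbrs (G : ColouredGraph (Fin n)) (u v : Fin n) : Finset (Fin n) :=
  {w | G.graph.Adj u w ∧ G.graph.Adj w v}

theorem mem_commonNbrs {G : ColouredGraph (Fin n)} {u v w : Fin n} :
    w ∈ commonNbrs G u v ↔ G.graph.Adj u w ∧ G.graph.Adj w v := by simp [commonNbrs]

open Classical in
/-- The edges, as increasing pairs, that lead from `u` or `v` to a common neighbour. -/
noncomputable def cherryEdges (G : ColouredGraph (Fin n)) (u v : Fin n) : Finset (Fin n × Fin n) :=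
  {e | e.1 < e.2 ∧ ∃ w ∈ commonNbrs G u v, s(e.1, e.2) = s(u, w) ∨ s(e.1, e.2) = s(w, v)}

/-- Each common neighbour accounts for two unordered edges, and an increasing pair is determined by
its unordered edge. -/
theorem card_cherryEdges_le (G : ColouredGraph (Fin n)) (u v : Fin n) :
    (cherryEdges G u v).card ≤ 2 * (commonNbrs G u v).card := by
  classical
  have hinj : Set.InjOn (fun e : Fin n × Fin n => s(e.1, e.2)) (cherryEdges G u v) := by
    intro e he e' he' h
    simp only [cherryEdges, Finset.coe_filter, Finset.mem_univ, true_and, Set.mem_ofPred_eq]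
      at he he'
    rcases Sym2.eq_iff.1 h with h | h
    · exact Prod.ext h.1 h.2
    · have h1 := he.1; have h2 := he'.1
      rw [h.1, h.2] at h1
      exact absurd h1 h2.not_gt
  rw [← Finset.card_image_of_injOn hinj, two_mul]
  refine (Finset.card_le_card (t := (commonNbrs G u v).image (fun w => s(u, w)) ∪
    (commonNbrs G u v).image (fun w => s(w, v))) fun x hx => ?_).trans
    ((Finset.card_union_le _ _).trans (add_le_add Finset.card_image_le Finset.card_image_le))
  obtain ⟨e, he, rfl⟩ := Finset.mem_image.1 hx
  obtain ⟨-, w, hw, h | h⟩ := (Finset.mem_filter.1 he).2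
  · exact Finset.mem_union_left _ (Finset.mem_image.2 ⟨w, hw, h.symm⟩)
  · exact Finset.mem_union_right _ (Finset.mem_image.2 ⟨w, hw, h.symm⟩)

theorem card_commonNbrs_le_flipEdge {G : ColouredGraph (Fin n)} {u v : Fin n}
    {e : Fin n × Fin n} (he : e.1 < e.2) (h : e ∉ cherryEdges G u v) :
    (commonNbrs G u v).card ≤ (commonNbrs (G.flipEdge e.1 e.2) u v).card := by
  refine Finset.card_le_card fun w hw => ?_
  simp only [cherryEdges, Finset.mem_filter, Finset.mem_univ, true_and, not_and, not_exists,
    not_or] at h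
  obtain ⟨h1, h2⟩ := h he w hw
  rw [mem_commonNbrs, flipEdge_adj_of_ne _ _ _ h1, flipEdge_adj_of_ne _ _ _ h2]
  exact mem_commonNbrs.1 hw

/-- Neither `u` nor `v` is itself a common neighbour, so an edge joining one of them to a common
neighbour `w` serves no other common neighbour. -/
theorem card_commonNbrs_le_flipEdge_add_one (G : ColouredGraph (Fin n)) {u v : Fin n}
    (huv : u ≠ v) (e : Fin n × Fin n) :
    (commonNbrs G u v).card ≤ (commonNbrs (G.flipEdge e.1 e.2) u v).card + 1 := by
  classical
  by_cases h : ∃ w ∈ commonNbrs G u v, s(e.1, e.2) = s(u, w) ∨ s(e.1, e.2) = s(w, v)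
  · obtain ⟨w, hw, hwe⟩ := h
    rw [← Finset.card_erase_add_one hw]
    refine Nat.add_le_add_right (Finset.card_le_card fun x hx => ?_) 1
    obtain ⟨hxw, hx⟩ := Finset.mem_erase.1 hx
    rw [mem_commonNbrs] at hx hw ⊢
    have hne := hx.1.ne; have hne2 := hx.2.ne; have hne3 := hw.1.ne; have hne4 := hw.2.ne
    rw [flipEdge_adj_of_ne, flipEdge_adj_of_ne]
    · exact hx
    · rcases hwe with h | h <;> rw [h, Ne, Sym2.eq_iff] <;> grind
    · rcases hwe with h | h <;> rw [h, Ne, Sym2.eq_iff] <;> grind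
  · push Not at h
    refine (Finset.card_le_card fun w hw => ?_).trans (Nat.le_succ _)
    rw [mem_commonNbrs, flipEdge_adj_of_ne _ _ _ (h w hw).1, flipEdge_adj_of_ne _ _ _ (h w hw).2]
    exact mem_commonNbrs.1 hw

/-- Only the loss of a common neighbour can increase the functional. A loss adds `(1 - q) * q ^ (N -
1)` and occurs at total rate at most `2 * θ.edgeBound * N`; gains help because `q ≤ 1`. -/
theorem generator_pow_card_commonNbrs_le (hθ : θ.Admissible) {u v : Fin n} (huv : u ≠ v) {q : ℝ}
    (hq : 0 < q) (hq1 : q ≤ 1) (G : ColouredGraph (Fin n)) :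
    generator θ n (fun G => q ^ (commonNbrs G u v).card) G ≤
      2 * θ.edgeBound * (1 - q) *
        ((commonNbrs G u v).card * q ^ ((commonNbrs G u v).card - 1)) := by
  classical
  set N := (commonNbrs G u v).card with hN
  have hnn : 0 ≤ (1 - q) * q ^ (N - 1) := mul_nonneg (by linarith) (by positivity)
  refine (generator_apply_le_of_graph hθ (fun w => rfl)
    (fun e => if e ∈ cherryEdges G u v then (1 - q) * q ^ (N - 1) else 0)
    (fun e => by split_ifs <;> [exact hnn; simp]) fun e he => ?_).trans ?_
  · split_ifs with hc
    · have h1 := card_commonNbrs_le_flipEdge_add_one G huv e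
      -- A cherry edge exists only when `N` is positive, so the truncated subtraction in `N - 1` is
      -- harmless.
      have hNpos : 0 < N := Finset.card_pos.2 <| by
        obtain ⟨-, w, hw, -⟩ := (Finset.mem_filter.1 hc).2
        exact ⟨w, hw⟩
      have h2 : q ^ (commonNbrs (G.flipEdge e.1 e.2) u v).card ≤ q ^ (N - 1) :=
        pow_le_pow_of_le_one hq.le hq1 (by omega)
      have h3 : q ^ N = q * q ^ (N - 1) := by
        rw [← pow_succ', Nat.sub_add_cancel hNpos]
      rw [← hN, h3]; linarith
    · exact sub_nonpos.2 (pow_le_pow_of_le_one hq.le hq1 (card_commonNbrs_le_flipEdge he hc))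
  · rw [Finset.sum_ite, Finset.sum_const_zero, add_zero, Finset.sum_const, nsmul_eq_mul]
    have hcard : ((({e : Fin n × Fin n | e.1 < e.2} : Finset _).filter
        (· ∈ cherryEdges G u v)).card : ℝ) ≤ 2 * N := by
      exact_mod_cast (Finset.card_le_card fun e he => (Finset.mem_filter.1 he).2).trans
        (card_cherryEdges_le G u v)
    calc _ ≤ θ.edgeBound * (2 * N * ((1 - q) * q ^ (N - 1))) :=
          mul_le_mul_of_nonneg_left (mul_le_mul_of_nonneg_right hcard hnn) hθ.edgeBound_nonneg
      _ = _ := by ring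

/-- The common neighbours survive at least as well as under independent thinning. -/
theorem transition_pow_card_commonNbrs_le (hθ : θ.Admissible) {u v : Fin n} (huv : u ≠ v) {t : ℝ}
    (ht : 0 ≤ t) (G : ColouredGraph (Fin n)) :
    (transition (generator θ n) t *ᵥ fun G => (1 / 2 : ℝ) ^ (commonNbrs G u v).card) G ≤
      (1 - Real.exp (-(2 * θ.edgeBound * t)) / 2) ^ (commonNbrs G u v).card := by
  set b := 2 * θ.edgeBound with hb
  have hb0 : 0 ≤ b := mul_nonneg zero_le_two hθ.edgeBound_nonneg
  have hA := isMarkovGenerator_generator hθ n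
  -- The solution of `q' = -b (1 - q)` with `q t = 1 / 2`: its time derivative cancels the generator
  -- bound exactly. The value at time `0` gives the generating function at `1 / 2` of a thinning
  -- with survival probability `exp (-(b * t))`.
  set q : ℝ → ℝ := fun r => 1 - Real.exp (b * (r - t)) / 2 with hq
  have hqd : ∀ r, HasDerivAt q (-(b * (1 - q r))) r := fun r => by
    have := ((((hasDerivAt_id r).sub_const t).const_mul b).exp.div_const 2).const_sub 1
    refine this.congr_deriv ?_
    simp only [hq, id]; ring
  have key := transition_mulVec_le_of_deriv_le (A := generator θ n)
    (F := fun r G => q r ^ (commonNbrs G u v).card)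
    (F' := fun r G => (commonNbrs G u v).card * q r ^ ((commonNbrs G u v).card - 1) *
      -(b * (1 - q r))) (fun r x => (hqd r).pow _)
    (B := fun _ => 0) (B' := fun _ => 0) (fun r => hasDerivAt_const _ _) ht G
    fun r hr hrt => ?_
  · have h0 : q t = 1 / 2 := by simp [hq]; norm_num
    have h1 : q 0 = 1 - Real.exp (-(b * t)) / 2 := by simp [hq]
    simpa only [h0, h1, sub_self, add_zero] using key
  · refine transition_mulVec_le hA hr (fun G' => ?_) G
    have he : Real.exp (b * (r - t)) ≤ 1 :=
      Real.exp_le_one_iff.2 (mul_nonpos_of_nonneg_of_nonpos hb0 (by linarith))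
    have := generator_pow_card_commonNbrs_le hθ huv (q := q r)
      (by simp only [hq]; linarith) (by simp only [hq]; linarith [Real.exp_pos (b * (r - t))]) G'
    simp only [Pi.add_apply]
    linarith

/-- Any two distinct vertices have at least `δ n` common neighbours. -/
noncomputable def WellConnected (δ : ℝ) (G : ColouredGraph (Fin n)) : Prop :=
  ∀ u v, u ≠ v → δ * n ≤ (commonNbrs G u v).card

-- Chernoff and union bounds over the pairs of vertices. The exponential moment is at most `exp (-(2
-- * δ * n))` and the threshold costs `exp (δ * n)`; the divisor `4` in `δ` is chosen to leave `exp
-- (-(δ * n))`.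
open Classical in
theorem transition_not_wellConnected_le (hθ : θ.Admissible) {ν t : ℝ}
    (ht : 0 ≤ t) {g : ColouredGraph (Fin n)} (hg : WellConnected ν g) :
    (transition (generator θ n) t *ᵥ fun G =>
        if WellConnected (Real.exp (-(2 * θ.edgeBound * t)) * ν / 4) G then 0 else 1) g ≤
      (n : ℝ) ^ 2 * Real.exp (-(Real.exp (-(2 * θ.edgeBound * t)) * ν / 4 * n)) := by
  have hA := isMarkovGenerator_generator hθ n
  set a := Real.exp (-(2 * θ.edgeBound * t)) with ha
  have ha0 : 0 < a := Real.exp_pos _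
  set δ := a * ν / 4 with hδ
  have h1 : ∀ G : ColouredGraph (Fin n), (if WellConnected δ G then (0 : ℝ) else 1) ≤
      ∑ p : Fin n × Fin n, if p.1 ≠ p.2 then
        Real.exp (δ * n) * (1 / 2 : ℝ) ^ (commonNbrs G p.1 p.2).card else 0 := by
    intro G
    have hnn : ∀ p : Fin n × Fin n, 0 ≤ (if p.1 ≠ p.2 then
        Real.exp (δ * n) * (1 / 2 : ℝ) ^ (commonNbrs G p.1 p.2).card else 0) := fun p => by
      split_ifs <;> positivity
    split_ifs with h
    · exact Finset.sum_nonneg fun p _ => hnn p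
    · simp only [WellConnected, not_forall, not_le] at h
      obtain ⟨u, v, huv, h⟩ := h
      refine le_trans ?_ (Finset.single_le_sum (fun p _ => hnn p) (Finset.mem_univ (u, v)))
      simp only [ne_eq, huv, not_false_eq_true, if_true]
      -- Fewer than `δ * n` common neighbours give `exp (δ * n) * exp (-1) ^ N ≥ 1`, and the base
      -- may be raised to `1 / 2`.
      have h2 : Real.exp (-1) ≤ (1 / 2 : ℝ) := by
        rw [Real.exp_neg, one_div]
        exact inv_anti₀ two_pos (by linarith [Real.add_one_le_exp (1 : ℝ)])
      calc (1 : ℝ) ≤ Real.exp (δ * n) * Real.exp (-1) ^ (commonNbrs G u v).card := by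
            rw [← Real.exp_nat_mul, ← Real.exp_add]
            exact Real.one_le_exp (by linarith)
        _ ≤ _ := by gcongr
  refine (transition_mulVec_mono hA ht h1 g).trans ?_
  have h2 : (fun G : ColouredGraph (Fin n) => ∑ p : Fin n × Fin n, if p.1 ≠ p.2 then
        Real.exp (δ * n) * (1 / 2 : ℝ) ^ (commonNbrs G p.1 p.2).card else 0) =
      ∑ p : Fin n × Fin n, (if p.1 ≠ p.2 then Real.exp (δ * n) else 0) •
        fun G => (1 / 2 : ℝ) ^ (commonNbrs G p.1 p.2).card := by
    ext G
    rw [Finset.sum_apply]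
    refine Finset.sum_congr rfl fun p _ => ?_
    split_ifs <;> simp
  rw [h2, ← Matrix.mulVecLin_apply, map_sum, Finset.sum_apply]
  calc _ ≤ ∑ p : Fin n × Fin n, Real.exp (-(δ * n)) := by
        refine Finset.sum_le_sum fun p _ => ?_
        rw [map_smul, Pi.smul_apply, smul_eq_mul, Matrix.mulVecLin_apply]
        split_ifs with hp
        · have h3 := transition_pow_card_commonNbrs_le hθ hp ht g
          have h4 : (1 - a / 2) ^ (commonNbrs g p.1 p.2).card ≤ Real.exp (-(2 * (δ * n))) := by
            have h5 : 1 - a / 2 ≤ Real.exp (-(a / 2)) := by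
              linarith [Real.add_one_le_exp (-(a / 2))]
            have ha1 : a ≤ 1 := Real.exp_le_one_iff.2 (by
              have := mul_nonneg (mul_nonneg zero_le_two hθ.edgeBound_nonneg) ht
              linarith)
            calc _ ≤ Real.exp (-(a / 2)) ^ (commonNbrs g p.1 p.2).card :=
                  pow_le_pow_left₀ (by linarith) h5 _
              _ ≤ _ := by
                rw [← Real.exp_nat_mul]
                refine Real.exp_le_exp.2 ?_
                have := mul_le_mul_of_nonneg_left (hg _ _ hp) (half_pos ha0).le
                rw [hδ]; linarith
          calc _ ≤ Real.exp (δ * n) * Real.exp (-(2 * (δ * n))) :=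
                mul_le_mul_of_nonneg_left (h3.trans h4) (Real.exp_nonneg _)
            _ = _ := by rw [← Real.exp_add]; congr 1; ring
        · rw [zero_mul]; exact (Real.exp_pos _).le
    _ = _ := by simp; ring

end GraphProcess

/-! ### Heat flow on a fixed graph: Dirichlet form, spectral gap, decay. -/

section HeatFlow

open scoped Matrix
open ColouredGraph

variable {n : ℕ}

/-- The generator of the random walk on the graph of `h` that crosses every edge at rate `η`. -/
noncomputable def walkGenerator (η : ℝ) (h : ColouredGraph (Fin n)) :
    (Fin n → ℝ) →ₗ[ℝ] (Fin n → ℝ) where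
  toFun f u := η * ∑ v, h.adj u v * (f v - f u)
  map_add' f g := by
    funext u
    simp only [Pi.add_apply, add_sub_add_comm, mul_add, Finset.sum_add_distrib]
  map_smul' a f := by
    funext u
    simp only [Pi.smul_apply, smul_eq_mul, RingHom.id_apply, ← mul_sub, mul_left_comm _ a,
      ← Finset.mul_sum]

theorem walkGenerator_apply (η : ℝ) (h : ColouredGraph (Fin n)) (f : Fin n → ℝ) (u : Fin n) :
    walkGenerator η h f u = η * ∑ v, h.adj u v * (f v - f u) := rfl

theorem isMarkovGenerator_walkGenerator {η : ℝ} (hη : 0 ≤ η) (h : ColouredGraph (Fin n)) :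
    IsMarkovGenerator (walkGenerator η h) where
  map_one := by ext u; simp [walkGenerator_apply]
  nonneg f u hf hu := by
    rw [walkGenerator_apply, hu]
    refine mul_nonneg hη (Finset.sum_nonneg fun v _ => mul_nonneg (h.adj_nonneg u v) ?_)
    simpa using hf v

/-- Summation by parts: averaging the sum with its transpose, by symmetry of the adjacency matrix,
produces the Dirichlet form. -/
theorem sum_walkGenerator_mul (η : ℝ) (h : ColouredGraph (Fin n)) (f g : Fin n → ℝ) :
    ∑ u, walkGenerator η h f u * g u =
      -(η / 2) * ∑ u, ∑ v, h.adj u v * ((f u - f v) * (g u - g v)) := by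
  have h1 : ∑ u, walkGenerator η h f u * g u =
      η * ∑ u, ∑ v, h.adj u v * ((f v - f u) * g u) := by
    simp only [walkGenerator_apply, Finset.mul_sum, Finset.sum_mul]
    exact Finset.sum_congr rfl fun u _ => Finset.sum_congr rfl fun v _ => by ring
  have h2 : ∑ u, ∑ v, h.adj u v * ((f v - f u) * g u) =
      ∑ u, ∑ v, h.adj u v * ((f u - f v) * g v) := by
    rw [Finset.sum_comm]
    exact Finset.sum_congr rfl fun u _ => Finset.sum_congr rfl fun v _ => by rw [h.adj_comm]
  have h3 : ∑ u, ∑ v, h.adj u v * ((f u - f v) * (g u - g v)) =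
      -(∑ u, ∑ v, h.adj u v * ((f v - f u) * g u)) -
        ∑ u, ∑ v, h.adj u v * ((f u - f v) * g v) := by
    rw [← Finset.sum_neg_distrib, ← Finset.sum_sub_distrib]
    refine Finset.sum_congr rfl fun u _ => ?_
    rw [← Finset.sum_neg_distrib, ← Finset.sum_sub_distrib]
    exact Finset.sum_congr rfl fun v _ => by ring
  rw [h1, h3, ← h2]; ring

theorem sum_walkGenerator_mul_comm (η : ℝ) (h : ColouredGraph (Fin n)) (f g : Fin n → ℝ) :
    ∑ u, walkGenerator η h f u * g u = ∑ u, f u * walkGenerator η h g u := by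
  simp_rw [mul_comm (f _)]
  rw [sum_walkGenerator_mul, sum_walkGenerator_mul]
  simp_rw [mul_comm (f _ - f _)]

theorem card_commonNbrs (h : ColouredGraph (Fin n)) (u v : Fin n) :
    ((commonNbrs h u v).card : ℝ) = ∑ w, h.adj u w * h.adj w v := by
  rw [commonNbrs, Finset.card_filter]
  push_cast
  refine Finset.sum_congr rfl fun w _ => ?_
  by_cases h1 : h.graph.Adj u w <;> by_cases h2 : h.graph.Adj w v <;> simp [adj, h1, h2]

/-- A Poincaré inequality: a graph in which any two vertices have many common neighbours has a
large spectral gap. -/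
theorem WellConnected.poincare {δ : ℝ} {h : ColouredGraph (Fin n)} (hδ : WellConnected δ h)
    {f : Fin n → ℝ} (hf : ∑ u, f u = 0) :
    δ * n / 2 * ∑ u, f u ^ 2 ≤ ∑ u, ∑ v, h.adj u v * ((f u - f v) * (f u - f v)) := by
  classical
  set E := ∑ u, ∑ v, h.adj u v * ((f u - f v) * (f u - f v)) with hE
  rcases Nat.eq_zero_or_pos n with rfl | hn
  · simp [hE]
  have hn' : (0 : ℝ) < n := Nat.cast_pos.2 hn
  have h1 : ∑ u, ∑ v, (f u - f v) ^ 2 = 2 * n * ∑ u, f u ^ 2 := by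
    have : ∀ u, ∑ v, (f u - f v) ^ 2 = n * f u ^ 2 + ∑ v, f v ^ 2 := fun u => by
      have e : ∀ v, (f u - f v) ^ 2 = f u ^ 2 + f v ^ 2 - 2 * f u * f v := fun v => by ring
      simp_rw [e]
      rw [Finset.sum_sub_distrib, Finset.sum_add_distrib, ← Finset.mul_sum, hf]
      simp
    simp_rw [this]
    rw [Finset.sum_add_distrib, ← Finset.mul_sum]
    simp; ring
  have h2 : δ * n * ∑ u, ∑ v, (f u - f v) ^ 2 ≤
      ∑ u, ∑ v, ∑ w, h.adj u w * h.adj w v * (f u - f v) ^ 2 := by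
    simp only [Finset.mul_sum]
    refine Finset.sum_le_sum fun u _ => Finset.sum_le_sum fun v _ => ?_
    rw [← Finset.sum_mul, ← card_commonNbrs]
    by_cases huv : u = v
    · simp [huv]
    · exact mul_le_mul_of_nonneg_right (hδ u v huv) (sq_nonneg _)
  -- Compare `f u` and `f v` along the path through `w`, split the square, and drop one adjacency
  -- factor from each part. Each ordered edge is then counted `n` times by the free vertex, with
  -- weight `2`, in each of the two parts.
  have h3 : ∑ u, ∑ v, ∑ w, h.adj u w * h.adj w v * (f u - f v) ^ 2 ≤
      ∑ u, ∑ v, ∑ w, (2 * (h.adj u w * ((f u - f w) * (f u - f w))) +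
        2 * (h.adj w v * ((f w - f v) * (f w - f v)))) := by
    refine Finset.sum_le_sum fun u _ => Finset.sum_le_sum fun v _ => Finset.sum_le_sum fun w _ => ?_
    have ha0 := h.adj_nonneg u w
    have ha1 := h.adj_le_one u w
    have hb0 := h.adj_nonneg w v
    have hb1 := h.adj_le_one w v
    have e1 : h.adj u w * h.adj w v ≤ h.adj u w := mul_le_of_le_one_right ha0 hb1
    have e2 : h.adj u w * h.adj w v ≤ h.adj w v := mul_le_of_le_one_left hb0 ha1
    have e3 := mul_le_mul_of_nonneg_right e1 (sq_nonneg (f u - f w))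
    have e4 := mul_le_mul_of_nonneg_right e2 (sq_nonneg (f w - f v))
    have e5 : (f u - f v) ^ 2 ≤ 2 * (f u - f w) ^ 2 + 2 * (f w - f v) ^ 2 := by
      nlinarith [sq_nonneg ((f u - f w) - (f w - f v))]
    have e6 := mul_le_mul_of_nonneg_left e5 (mul_nonneg ha0 hb0)
    nlinarith
  have h4 : ∑ u, ∑ v, ∑ w, (2 * (h.adj u w * ((f u - f w) * (f u - f w))) +
        2 * (h.adj w v * ((f w - f v) * (f w - f v)))) = 4 * n * E := by
    have a : ∑ u, ∑ _v : Fin n, ∑ w, 2 * (h.adj u w * ((f u - f w) * (f u - f w))) =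
        2 * n * E := by
      simp only [Finset.sum_const, Finset.card_univ, Fintype.card_fin, nsmul_eq_mul,
        ← Finset.mul_sum, ← hE]
      ring
    have b : ∑ _u : Fin n, ∑ v, ∑ w, 2 * (h.adj w v * ((f w - f v) * (f w - f v))) =
        2 * n * E := by
      rw [Finset.sum_const, Finset.sum_comm]
      simp only [Finset.card_univ, Fintype.card_fin, nsmul_eq_mul, ← Finset.mul_sum, ← hE]
      ring
    simp only [Finset.sum_add_distrib]
    rw [a, b]; ring
  rw [h1] at h2
  have h5 := h2.trans (h3.trans_eq h4)
  refine le_of_mul_le_mul_left ?_ (by positivity : 0 < 4 * (n : ℝ))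
  linarith

theorem sum_heat_eq_zero (η : ℝ) (h : ColouredGraph (Fin n)) {φ : Fin n → ℝ}
    (hφ : ∑ u, φ u = 0) (t : ℝ) : ∑ u, (transition (walkGenerator η h) t *ᵥ φ) u = 0 := by
  have hd : ∀ r, HasDerivAt (fun r => ∑ u, (transition (walkGenerator η h) r *ᵥ φ) u) 0 r := by
    intro r
    have := HasDerivAt.fun_sum (u := Finset.univ) fun u (_ : u ∈ Finset.univ) =>
      hasDerivAt_transition_mulVec (walkGenerator η h) (F := fun _ => φ) (F' := 0) (t := r)
      (fun y => hasDerivAt_const _ _) u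
    refine this.congr_deriv ?_
    rw [add_zero, transition_mulVec_map]
    have := sum_walkGenerator_mul η h (transition (walkGenerator η h) r *ᵥ φ) 1
    simpa using this
  have := is_const_of_deriv_eq_zero (fun r => (hd r).differentiableAt) (fun r => (hd r).deriv) t 0
  simpa [transition_zero, hφ] using this

/-- The derivative of the squared norm is `-η` times the Dirichlet form. The flow preserves the zero
sum, so the Poincaré inequality applies at every time. -/
theorem sum_heat_sq_le {η δ : ℝ} (hη : 0 ≤ η) {h : ColouredGraph (Fin n)}
    (hδ : WellConnected δ h) {φ : Fin n → ℝ} (hφ : ∑ u, φ u = 0) {t : ℝ} (ht : 0 ≤ t) :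
    ∑ u, (transition (walkGenerator η h) t *ᵥ φ) u ^ 2 ≤
      Real.exp (-(η * δ * n / 2 * t)) * ∑ u, φ u ^ 2 := by
  set k := η * δ * n / 2 with hk
  set ψ : ℝ → Fin n → ℝ := fun r => transition (walkGenerator η h) r *ᵥ φ with hψ
  have hd : ∀ r u, HasDerivAt (fun r => ψ r u) (walkGenerator η h (ψ r) u) r := fun r u => by
    have := hasDerivAt_transition_mulVec (walkGenerator η h) (F := fun _ => φ) (F' := 0) (t := r)
      (fun y => hasDerivAt_const _ _) u
    rwa [add_zero, transition_mulVec_map] at this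
  have hS : ∀ r, HasDerivAt (fun r => Real.exp (k * r) * ∑ u, ψ r u ^ 2)
      (Real.exp (k * r) * (k * ∑ u, ψ r u ^ 2 + 2 * ∑ u, walkGenerator η h (ψ r) u * ψ r u)) r := by
    intro r
    have h1 := HasDerivAt.fun_sum (u := Finset.univ) fun u (_ : u ∈ Finset.univ) => (hd r u).fun_pow 2
    have h2 := (((hasDerivAt_id r).const_mul k).exp).mul h1
    refine h2.congr_deriv ?_
    simp only [id, Finset.mul_sum, mul_add, mul_one]
    congr 1
    · exact Finset.sum_congr rfl fun u _ => by ring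
    · exact Finset.sum_congr rfl fun u _ => by norm_num; ring
  have hanti : Antitone fun r => Real.exp (k * r) * ∑ u, ψ r u ^ 2 := by
    refine antitone_of_deriv_nonpos (fun r => (hS r).differentiableAt) fun r => ?_
    rw [(hS r).deriv]
    refine mul_nonpos_of_nonneg_of_nonpos (Real.exp_nonneg _) ?_
    rw [sum_walkGenerator_mul]
    have := mul_le_mul_of_nonneg_left (hδ.poincare (sum_heat_eq_zero η h hφ r)) hη
    simp only [hψ, hk]
    linarith
  have := hanti ht
  simp only [mul_zero, Real.exp_zero, one_mul] at this
  have h0 : ψ 0 = φ := by simp [hψ, transition_zero]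
  rw [h0] at this
  rw [Real.exp_neg, ← div_eq_inv_mul, le_div_iff₀ (Real.exp_pos _), mul_comm]
  exact this

end HeatFlow

/-! ### Decorrelation of the colours from the graph over a short window. -/

section Decorrelation

open scoped Matrix
open ColouredGraph

variable {θ : VoterParams} {n : ℕ}

theorem abs_sum_div_le {a b : Fin n → ℝ} {C : ℝ} (hC : 0 ≤ C) (ha : ∀ u, |a u| ≤ C)
    (hb : ∀ u, |b u| ≤ 1) : |(∑ u, a u * b u) / n| ≤ C := by
  rcases Nat.eq_zero_or_pos n with rfl | hn
  · simpa using hC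
  rw [abs_div, Nat.abs_cast, div_le_iff₀ (Nat.cast_pos.2 hn)]
  refine (Finset.abs_sum_le_sum_abs _ _).trans ?_
  calc _ ≤ ∑ _u : Fin n, C := Finset.sum_le_sum fun u _ => by
        rw [abs_mul]
        exact (mul_le_of_le_one_right (abs_nonneg _) (hb u)).trans (ha u)
    _ = C * n := by simp [mul_comm]

theorem abs_col_le_one (G : ColouredGraph (Fin n)) (u : Fin n) : |G.col u| ≤ 1 := by
  rw [abs_of_nonneg (G.col_nonneg u)]; exact G.col_le_one u

/-- Over a time interval that is long for the random walk but short for the edges, the colours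
decorrelate from the initial graph. -/
theorem transition_sq_sum_col_le (hθ : θ.Admissible) {δ : ℝ} (hn : 0 < n)
    {h : ColouredGraph (Fin n)} (hδ : WellConnected δ h) {φ : Fin n → ℝ} (hφ : ∑ u, φ u = 0)
    (hφ2 : ∀ u, |φ u| ≤ 2) {ε : ℝ} (hε : 0 ≤ ε) :
    (transition (generator θ n) ε *ᵥ fun G => ((∑ u, φ u * G.col u) / n) ^ 2) h ≤
      4 * Real.exp (-(θ.η * δ * n / 2 * ε)) + 4 * θ.η * ε +
        8 * θ.η * θ.edgeBound * n * ε ^ 2 := by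
  have hη := hθ.η_pos
  have hA := isMarkovGenerator_generator hθ n
  have hL := isMarkovGenerator_walkGenerator hη.le h
  have hn' : (0 : ℝ) < n := Nat.cast_pos.2 hn
  -- The backward heat flow of the frozen graph `h`, ending at `φ` at time `ε`. Its time derivative
  -- would cancel the drift of the colours exactly if the graph stayed equal to `h`.
  set ψ : ℝ → Fin n → ℝ := fun r => transition (walkGenerator θ.η h) (ε - r) *ᵥ φ with hψ
  have hψd : ∀ r u, HasDerivAt (fun r => ψ r u) (-walkGenerator θ.η h (ψ r) u) r := fun r u => by
    have h1 := hasDerivAt_transition_mulVec (walkGenerator θ.η h) (F := fun _ => φ) (F' := 0)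
      (t := ε - r) (fun y => hasDerivAt_const _ _) u
    rw [add_zero, transition_mulVec_map] at h1
    exact (h1.comp r ((hasDerivAt_id r).const_sub ε)).congr_deriv (mul_neg_one _)
  have hψ2 : ∀ r, r ≤ ε → ∀ u, |ψ r u| ≤ 2 := fun r hr u =>
    abs_le.2 ⟨le_transition_mulVec hL (sub_nonneg.2 hr) (fun v => (abs_le.1 (hφ2 v)).1) u,
      transition_mulVec_le hL (sub_nonneg.2 hr) (fun v => (abs_le.1 (hφ2 v)).2) u⟩
  set H : ℝ → ColouredGraph (Fin n) → ℝ := fun r G => (∑ u, ψ r u * G.col u) / n with hH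
  have hHd : ∀ r G, HasDerivAt (fun r => H r G)
      (-(∑ u, ψ r u * walkGenerator θ.η h G.col u) / n) r := fun r G => by
    have h1 := HasDerivAt.fun_sum (u := Finset.univ) fun u (_ : u ∈ Finset.univ) =>
      (hψd r u).mul_const (G.col u)
    refine (h1.div_const (n : ℝ)).congr_deriv ?_
    rw [← sum_walkGenerator_mul_comm, ← Finset.sum_neg_distrib]
    simp only [neg_mul]
  have hHflip : ∀ r G u, H r (G.flipColour u) = H r G + ψ r u * (1 - 2 * G.col u) / n := by
    intro r G u
    simp only [hH, ← add_div, col_flipColour, mul_add, Finset.sum_add_distrib, mul_ite, mul_zero]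
    rw [Finset.sum_ite_eq' Finset.univ u]
    simp
  have hgen : ∀ r, r ≤ ε → ∀ G, generator θ n (fun G => H r G ^ 2) G ≤
      2 * H r G * ((∑ u, ψ r u * walkGenerator θ.η G G.col u) / n) + 4 * θ.η := by
    intro r hr G
    -- The chain rule for a jump process: a first-order drift plus the squared jumps. Edge switches
    -- contribute nothing because `H` sees only colours.
    have e1 : generator θ n (fun G => H r G ^ 2) G =
        2 * H r G * ((∑ u, ψ r u * walkGenerator θ.η G G.col u) / n) +
          θ.η * ∑ u, vertexRate G u * ((ψ r u * (1 - 2 * G.col u)) ^ 2 / n ^ 2) := by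
      rw [generator_apply]
      have hz : ∀ e : Fin n × Fin n, H r (G.flipEdge e.1 e.2) = H r G := fun e => rfl
      simp only [hz, sub_self, mul_zero, Finset.sum_const_zero, add_zero, hHflip,
        walkGenerator_apply, ← vertexRate_eq, Finset.mul_sum, Finset.sum_div,
        ← Finset.sum_add_distrib]
      refine Finset.sum_congr rfl fun u _ => ?_
      field_simp
      ring
    rw [e1]
    -- There are `n` vertices, each of rate at most `n`, with jumps of size at most `2 / n`.
    have e2 : ∑ u, vertexRate G u * ((ψ r u * (1 - 2 * G.col u)) ^ 2 / n ^ 2) ≤ 4 := by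
      calc _ ≤ ∑ _u : Fin n, (n : ℝ) * (2 ^ 2 / n ^ 2) := by
            refine Finset.sum_le_sum fun u _ => ?_
            have h1 : |ψ r u * (1 - 2 * G.col u)| ≤ 2 := by
              rw [abs_mul]
              refine (mul_le_of_le_one_right (abs_nonneg _) ?_).trans (hψ2 r hr u)
              rw [abs_le]
              constructor <;> linarith [G.col_nonneg u, G.col_le_one u]
            have h2 : (ψ r u * (1 - 2 * G.col u)) ^ 2 ≤ 2 ^ 2 := by
              rw [← sq_abs]; exact pow_le_pow_left₀ (abs_nonneg _) h1 2
            exact mul_le_mul (vertexRate_le G u) (by gcongr) (by positivity) (by positivity)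
        _ = 4 := by simp; field_simp; norm_num
    have := mul_le_mul_of_nonneg_left e2 hη.le
    linarith
  have hdrift : ∀ r, r ≤ ε → ∀ G, generator θ n (fun G => H r G ^ 2) G +
      2 * H r G * (-(∑ u, ψ r u * walkGenerator θ.η h G.col u) / n) ≤
      4 * θ.η + 8 * θ.η / n * edgeDiff h G := by
    intro r hr G
    have h1 := hgen r hr G
    have hHb : |H r G| ≤ 2 := abs_sum_div_le zero_le_two (hψ2 r hr) (abs_col_le_one G)
    -- Self-adjointness has moved the walk on `h` from `ψ` to the colours, so only the difference of
    -- the two adjacency matrices is left.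
    have e : (∑ u, ψ r u * walkGenerator θ.η G G.col u) / n +
        -(∑ u, ψ r u * walkGenerator θ.η h G.col u) / n =
        θ.η / n * ∑ u, ∑ v, ψ r u * ((G.adj u v - h.adj u v) * (G.col v - G.col u)) := by
      rw [← add_div, ← sub_eq_add_neg, ← Finset.sum_sub_distrib, div_mul_eq_mul_div,
        Finset.mul_sum]
      congr 1
      refine Finset.sum_congr rfl fun u _ => ?_
      simp only [walkGenerator_apply, ← Finset.mul_sum, sub_mul, Finset.sum_sub_distrib]
      ring
    have hb : |∑ u, ∑ v, ψ r u * ((G.adj u v - h.adj u v) * (G.col v - G.col u))| ≤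
        2 * edgeDiff h G := by
      rw [edgeDiff, Finset.mul_sum]
      refine (Finset.abs_sum_le_sum_abs _ _).trans (Finset.sum_le_sum fun u _ => ?_)
      rw [Finset.mul_sum]
      refine (Finset.abs_sum_le_sum_abs _ _).trans (Finset.sum_le_sum fun v _ => ?_)
      rw [abs_mul, abs_mul]
      exact mul_le_mul (hψ2 r hr u)
        (mul_le_of_le_one_right (abs_nonneg _) (G.abs_col_sub_col_le v u)) (by positivity)
        zero_le_two
    have e2 : 2 * H r G * (θ.η / n *
        ∑ u, ∑ v, ψ r u * ((G.adj u v - h.adj u v) * (G.col v - G.col u))) ≤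
        2 * 2 * (θ.η / n * (2 * edgeDiff h G)) := by
      refine (le_abs_self _).trans ?_
      rw [abs_mul, abs_mul, abs_mul, abs_two, abs_of_nonneg (by positivity : 0 ≤ θ.η / n)]
      have := edgeDiff_nonneg G h
      gcongr
    rw [← e] at e2
    calc _ ≤ 2 * 2 * (θ.η / n * (2 * edgeDiff h G)) + 4 * θ.η := by linarith
      _ = _ := by ring
  have key := transition_mulVec_le_of_deriv_le (A := generator θ n)
    (F := fun r G => H r G ^ 2)
    (F' := fun r G => 2 * H r G * (-(∑ u, ψ r u * walkGenerator θ.η h G.col u) / n))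
    (fun r G => ((hHd r G).fun_pow 2).congr_deriv (by simp))
    -- The primitive of the drift bound once the expected `edgeDiff` is replaced by `2 * θ.edgeBound
    -- * n ^ 2 * r`.
    (B := fun r => 4 * θ.η * r + 8 * θ.η * θ.edgeBound * n * r ^ 2)
    (B' := fun r => 4 * θ.η + 16 * θ.η * θ.edgeBound * n * r)
    (fun r => by
      refine (((hasDerivAt_id r).const_mul (4 * θ.η)).add
        (((hasDerivAt_id r).pow 2).const_mul (8 * θ.η * θ.edgeBound * n))).congr_deriv ?_
      simp; ring) hε h fun r hr hrε => ?_
  · have hε0 : ψ ε = φ := by simp [hψ, transition_zero]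
    have h0 : H 0 h ^ 2 ≤ 4 * Real.exp (-(θ.η * δ * n / 2 * ε)) := by
      -- Cauchy–Schwarz: the decay of the transported weight suffices, whatever the initial colours
      -- are.
      have h1 : (∑ u, ψ 0 u * h.col u) ^ 2 ≤ (∑ u, ψ 0 u ^ 2) * ∑ u, h.col u ^ 2 :=
        Finset.sum_mul_sq_le_sq_mul_sq _ _ _
      have h2 : ∑ u, h.col u ^ 2 ≤ n := by
        refine (Finset.sum_le_sum (g := fun _ => (1 : ℝ)) fun u _ => ?_).trans_eq (by simp)
        exact pow_le_one₀ (h.col_nonneg u) (h.col_le_one u)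
      have h3 : ∑ u, ψ 0 u ^ 2 ≤ Real.exp (-(θ.η * δ * n / 2 * ε)) * ∑ u, φ u ^ 2 := by
        simpa only [hψ, sub_zero] using sum_heat_sq_le hη.le hδ hφ hε
      have h4 : ∑ u, φ u ^ 2 ≤ 4 * n := by
        refine (Finset.sum_le_sum (g := fun _ => (4 : ℝ)) fun u _ => ?_).trans_eq
          (by simp [mul_comm])
        rw [← sq_abs]
        exact (pow_le_pow_left₀ (abs_nonneg _) (hφ2 u) 2).trans_eq (by norm_num)
      simp only [hH, div_pow]
      rw [div_le_iff₀ (by positivity)]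
      calc _ ≤ _ := h1
        _ ≤ (Real.exp (-(θ.η * δ * n / 2 * ε)) * (4 * n)) * n := by
          refine mul_le_mul (h3.trans (by gcongr)) h2
            (Finset.sum_nonneg fun u _ => sq_nonneg _) (by positivity)
        _ = _ := by ring
    simp only [hH, hε0, mul_zero, ne_eq, OfNat.ofNat_ne_zero, not_false_eq_true, zero_pow,
      add_zero, sub_zero] at key h0 ⊢
    linarith
  · refine (transition_mulVec_mono hA hr (hdrift r hrε) h).trans ?_
    have e : (fun G => 4 * θ.η + 8 * θ.η / n * edgeDiff h G) =
        (fun _ => 4 * θ.η) + (8 * θ.η / n) • edgeDiff h := by ext; simp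
    rw [e, Matrix.mulVec_add, Matrix.mulVec_smul, Pi.add_apply, Pi.smul_apply, smul_eq_mul,
      transition_mulVec_const hA]
    have h1 := mul_le_mul_of_nonneg_left (transition_edgeDiff_le hθ h hr)
      (by positivity : 0 ≤ 8 * θ.η / n)
    have e2 : 8 * θ.η / n * (2 * θ.edgeBound * n ^ 2 * r) = 16 * θ.η * θ.edgeBound * n * r := by
      field_simp; ring
    linarith

end Decorrelation

/-! ### Graphons of finite graphs as step functions. -/

section StepFunctions

open ColouredGraph

variable {n : ℕ}

/-- The cell of the equipartition of `[0,1]` into `n` intervals that contains `x`. -/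
noncomputable def cell (hn : 0 < n) (x : I) : Fin n :=
  ⟨max ⌈(n : ℝ) * x⌉₊ 1 - 1, by
    have h : ⌈(n : ℝ) * x⌉₊ ≤ n :=
      Nat.ceil_le.2 (mul_le_of_le_one_right (Nat.cast_nonneg n) x.2.2)
    omega⟩

theorem isCell_iff (hn : 0 < n) {x : I} {i : Fin n} : IsCell n x i ↔ cell hn x = i := by
  rw [IsCell, Fin.ext_iff, cell]
  dsimp only
  omega

theorem measurable_cell (hn : 0 < n) : Measurable (cell hn) := by
  have h : Measurable fun x : I => ⌈(n : ℝ) * x⌉₊ := Nat.measurable_ceil.comp (by fun_prop)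
  refine measurable_to_countable' fun i => ?_
  have : cell hn ⁻¹' {i} = (fun x : I => ⌈(n : ℝ) * x⌉₊) ⁻¹' {k | max k 1 - 1 = i} := by
    ext x; simp [cell, Fin.ext_iff]
  rw [this]
  exact h (Set.to_countable _).measurableSet

/-- The cell lies between the half-open and the closed interval from `i / n` to `(i + 1) / n`, which
have equal measure; this absorbs the exceptional point `0` of the first cell. -/
theorem volume_cell_preimage (hn : 0 < n) (i : Fin n) :
    (volume : Measure I) (cell hn ⁻¹' {i}) = ENNReal.ofReal (n : ℝ)⁻¹ := by
  have hn' : (0 : ℝ) < n := Nat.cast_pos.2 hn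
  have hi : ((i : ℕ) : ℝ) + 1 ≤ n := by exact_mod_cast i.2
  let a : I := ⟨(i : ℕ) / n, by positivity, by rw [div_le_one hn']; linarith⟩
  let b : I := ⟨((i : ℕ) + 1) / n, by positivity, by rw [div_le_one hn']; linarith⟩
  have hab : (b : ℝ) - a = (n : ℝ)⁻¹ := by simp only [a, b]; field_simp; ring
  refine le_antisymm ?_ ?_
  · refine (measure_mono (t := Icc a b) fun x hx => ?_).trans_eq (by simp [hab])
    have h := (isCell_iff hn).2 hx
    rw [IsCell] at h
    constructor
    · rw [← Subtype.coe_le_coe]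
      simp only [a]
      rw [div_le_iff₀ hn', mul_comm]
      rcases Nat.eq_zero_or_pos (i : ℕ) with h0 | h0
      · rw [h0, Nat.cast_zero]; exact mul_nonneg hn'.le x.2.1
      · exact (Nat.lt_ceil.1 (by omega : (i : ℕ) < ⌈(n : ℝ) * x⌉₊)).le
    · rw [← Subtype.coe_le_coe]
      simp only [b]
      rw [le_div_iff₀ hn', mul_comm]
      have := Nat.ceil_le.1 (by omega : ⌈(n : ℝ) * x⌉₊ ≤ (i : ℕ) + 1)
      exact_mod_cast this
  · refine le_of_eq_of_le (by simp [hab]) (measure_mono (s := Ioc a b) fun x hx => ?_)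
    refine (isCell_iff hn).1 ?_
    have h1 : ((i : ℕ) : ℝ) < n * x := by
      have h := Subtype.coe_lt_coe.2 hx.1
      simp only [a] at h
      rwa [div_lt_iff₀ hn', mul_comm] at h
    have h2 : (n : ℝ) * x ≤ ((i : ℕ) + 1 : ℕ) := by
      have h := Subtype.coe_le_coe.2 hx.2
      simp only [b] at h
      rw [le_div_iff₀ hn', mul_comm] at h
      exact_mod_cast h
    have h3 := Nat.lt_ceil.2 h1
    have h4 := Nat.ceil_le.2 h2
    rw [IsCell]; omega

theorem integral_cell (hn : 0 < n) (f : Fin n → ℝ) : ∫ x : I, f (cell hn x) = (∑ u, f u) / n := by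
  have hm := measurable_cell hn
  have hp : IsProbabilityMeasure ((volume : Measure I).map (cell hn)) :=
    Measure.isProbabilityMeasure_map hm.aemeasurable
  rw [← integral_map (φ := cell hn) (f := f) hm.aemeasurable
    (measurable_of_countable f).aestronglyMeasurable, integral_fintype Integrable.of_finite,
    Finset.sum_div]
  refine Finset.sum_congr rfl fun u _ => ?_
  rw [measureReal_def, Measure.map_apply hm (measurableSet_singleton u), volume_cell_preimage hn,
    ENNReal.toReal_ofReal (by positivity), smul_eq_mul, inv_mul_eq_div]

theorem integral_cell_pi (hn : 0 < n) {m : ℕ} (f : (Fin m → Fin n) → ℝ) :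
    ∫ x : Fin m → I, f (fun i => cell hn (x i)) = (∑ v, f v) / n ^ m := by
  have hm := measurable_cell hn
  have hp : IsProbabilityMeasure ((volume : Measure I).map (cell hn)) :=
    Measure.isProbabilityMeasure_map hm.aemeasurable
  have hmp : MeasurePreserving (cell hn) volume ((volume : Measure I).map (cell hn)) :=
    ⟨hm, rfl⟩
  have h := measurePreserving_pi (fun _ : Fin m => (volume : Measure I))
    (fun _ => (volume : Measure I).map (cell hn)) (fun _ => hmp)
  have h1 : ∫ x : Fin m → I, f (fun i => cell hn (x i)) =
      ∫ v, f v ∂(Measure.pi fun _ : Fin m => (volume : Measure I).map (cell hn)) := by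
    rw [← h.map_eq, integral_map h.measurable.aemeasurable
      (measurable_of_countable f).aestronglyMeasurable]
    rfl
  rw [h1, integral_fintype Integrable.of_finite, Finset.sum_div]
  refine Finset.sum_congr rfl fun v _ => ?_
  rw [measureReal_def, Measure.pi_singleton]
  simp only [Measure.map_apply hm (measurableSet_singleton _), volume_cell_preimage hn,
    Finset.prod_const, Finset.card_univ, Fintype.card_fin, ENNReal.toReal_pow]
  rw [ENNReal.toReal_ofReal (by positivity), smul_eq_mul, inv_pow, inv_mul_eq_div]

theorem toGraphon_κ (hn : 0 < n) (G : ColouredGraph (Fin n)) (x y : I) :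
    G.toGraphon.κ x y = G.adj (cell hn x) (cell hn y) := by
  simp only [toGraphon, adj]
  congr 1
  refine propext ⟨fun ⟨i, j, hi, hj, hij⟩ => ?_, fun h =>
    ⟨_, _, (isCell_iff hn).2 rfl, (isCell_iff hn).2 rfl, h⟩⟩
  rwa [(isCell_iff hn).1 hi, (isCell_iff hn).1 hj]

theorem toGraphon_c (hn : 0 < n) (G : ColouredGraph (Fin n)) (x : I) :
    G.toGraphon.c x = G.col (cell hn x) := by
  simp only [toGraphon, isCell_iff hn, col]
  simp

/-- The proportion of vertices of colour `1`. -/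
noncomputable def ColouredGraph.meanCol (G : ColouredGraph (Fin n)) : ℝ := (∑ u, G.col u) / n

theorem meanColour_toGraphon (hn : 0 < n) (G : ColouredGraph (Fin n)) :
    G.toGraphon.meanColour = G.meanCol := by
  simp only [ColouredGraphon.meanColour, toGraphon_c hn, meanCol]
  exact integral_cell hn _

theorem meanCol_nonneg (G : ColouredGraph (Fin n)) : 0 ≤ G.meanCol :=
  div_nonneg (Finset.sum_nonneg fun u _ => G.col_nonneg u) (Nat.cast_nonneg n)

theorem meanCol_le_one (G : ColouredGraph (Fin n)) : G.meanCol ≤ 1 :=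
  div_le_one_of_le₀ ((Finset.sum_le_sum fun u _ => G.col_le_one u).trans_eq (by simp))
    (Nat.cast_nonneg n)

/-- Every cell has positive measure, hence contains a point, so the infimum over points of the
interval bounds the normalised count for each pair of vertices. -/
theorem wellConnected_of_le_connectedness {G : ColouredGraph (Fin n)} {ν : ℝ}
    (hν : ν ≤ G.toGraphon.connectedness) : WellConnected ν G := by
  intro u v _
  have hn : 0 < n := u.pos
  have hsurj : ∀ u : Fin n, ∃ x : I, cell hn x = u := fun u => by
    have h : (volume : Measure I) (cell hn ⁻¹' {u}) ≠ 0 := by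
      rw [volume_cell_preimage hn, Ne, ENNReal.ofReal_eq_zero, not_le]
      exact inv_pos.2 (Nat.cast_pos.2 hn)
    exact nonempty_of_measure_ne_zero h
  obtain ⟨x, hx⟩ := hsurj u
  obtain ⟨y, hy⟩ := hsurj v
  have hbdd : BddBelow (range fun p : I × I => ∫ z, G.toGraphon.κ p.1 z * G.toGraphon.κ z p.2) :=
    ⟨0, by
      rintro _ ⟨p, rfl⟩
      exact integral_nonneg fun z =>
        mul_nonneg (G.toGraphon.κ_mem _ _).1 (G.toGraphon.κ_mem _ _).1⟩
  have h := hν.trans (ciInf_le hbdd (x, y))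
  simp only [toGraphon_κ hn, hx, hy] at h
  rw [integral_cell hn fun w => G.adj u w * G.adj w v, le_div_iff₀ (Nat.cast_pos.2 hn)] at h
  rwa [card_commonNbrs]

end StepFunctions

/-! ### Subgraph densities and the effect of averaging the colours. -/

section Densities

open ColouredGraph

variable {m n : ℕ}

open Classical in
/-- The edges of a graph as increasing pairs. -/
noncomputable def edgePairs (F : ColouredGraph (Fin m)) : Finset (Fin m × Fin m) :=
  {e | e.1 < e.2 ∧ F.graph.Adj e.1 e.2}

theorem mem_edgePairs {F : ColouredGraph (Fin m)} {e : Fin m × Fin m} :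
    e ∈ edgePairs F ↔ e.1 < e.2 ∧ F.graph.Adj e.1 e.2 := by simp [edgePairs]

/-- Whether the map `v` sends the edges of `F` to edges of `G`. -/
noncomputable def edgeWeight (F : ColouredGraph (Fin m)) (G : ColouredGraph (Fin n))
    (v : Fin m → Fin n) : ℝ := ∏ e ∈ edgePairs F, G.adj (v e.1) (v e.2)

theorem edgeWeight_nonneg (F : ColouredGraph (Fin m)) (G : ColouredGraph (Fin n))
    (v : Fin m → Fin n) : 0 ≤ edgeWeight F G v := Finset.prod_nonneg fun _ _ => G.adj_nonneg _ _

theorem edgeWeight_le_one (F : ColouredGraph (Fin m)) (G : ColouredGraph (Fin n))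
    (v : Fin m → Fin n) : edgeWeight F G v ≤ 1 :=
  Finset.prod_le_one (fun _ _ => G.adj_nonneg _ _) fun _ _ => G.adj_le_one _ _

theorem abs_prod_sub_prod_le {ι : Type*} (s : Finset ι) {a b : ι → ℝ}
    (ha : ∀ i, 0 ≤ a i ∧ a i ≤ 1) (hb : ∀ i, 0 ≤ b i ∧ b i ≤ 1) :
    |∏ i ∈ s, a i - ∏ i ∈ s, b i| ≤ ∑ i ∈ s, |a i - b i| := by
  classical
  induction s using Finset.induction_on with
  | empty => simp
  | insert i s hi ih =>
    rw [Finset.prod_insert hi, Finset.prod_insert hi, Finset.sum_insert hi]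
    have e : a i * ∏ j ∈ s, a j - b i * ∏ j ∈ s, b j =
        (a i - b i) * ∏ j ∈ s, a j + b i * (∏ j ∈ s, a j - ∏ j ∈ s, b j) := by ring
    rw [e]
    refine (abs_add_le _ _).trans (add_le_add ?_ ?_)
    · rw [abs_mul, abs_of_nonneg (Finset.prod_nonneg fun j _ => (ha j).1)]
      exact mul_le_of_le_one_right (abs_nonneg _)
        (Finset.prod_le_one (fun j _ => (ha j).1) fun j _ => (ha j).2)
    · rw [abs_mul, abs_of_nonneg (hb i).1]
      exact (mul_le_of_le_one_left (abs_nonneg _) (hb i).2).trans ih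

/-- Resampling one coordinate does not change a sum over all maps. -/
theorem sum_sum_update (i : Fin m) (f : (Fin m → Fin n) → ℝ) :
    ∑ v : Fin m → Fin n, ∑ u : Fin n, f (Function.update v i u) = n * ∑ v, f v := by
  have h1 : ∑ v : Fin m → Fin n, ∑ u : Fin n, f (Function.update v i u) =
      ∑ p : (Fin m → Fin n) × Fin n, f (Function.update p.1 i p.2) :=
    (Fintype.sum_prod_type' (f := fun v u => f (Function.update v i u))).symm
  have h2 : n * ∑ v, f v = ∑ p : (Fin m → Fin n) × Fin n, f p.1 := by
    rw [Fintype.sum_prod_type, Finset.mul_sum]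
    simp
  rw [h1, h2]
  -- Exchanging the `i`-th coordinate with the extra vertex is an involution that carries one sum to
  -- the other.
  let e : Equiv.Perm ((Fin m → Fin n) × Fin n) :=
    Function.Involutive.toPerm (fun p => (Function.update p.1 i p.2, p.1 i)) fun p => by
      ext <;> simp
  exact Fintype.sum_equiv e _ _ fun p => rfl

theorem sum_pair (hn : 0 < n) {i j : Fin m} (hij : i ≠ j) (f : Fin n → Fin n → ℝ) :
    (∑ v : Fin m → Fin n, f (v i) (v j)) / n ^ m = (∑ x, ∑ y, f x y) / n ^ 2 := by
  have h1 := sum_sum_update (n := n) i fun v => f (v i) (v j)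
  have h2 := sum_sum_update (n := n) j fun v => ∑ u, f u (v j)
  simp only [Function.update_self, Function.update_of_ne hij.symm] at h1 h2
  rw [h1] at h2
  simp only [Finset.sum_const, Finset.card_univ, Fintype.card_fun, Fintype.card_fin,
    nsmul_eq_mul] at h2
  rw [Finset.sum_comm] at h2
  have hn' : (n : ℝ) ≠ 0 := (Nat.cast_pos.2 hn).ne'
  rw [div_eq_div_iff (by positivity) (by positivity)]
  push_cast at h2
  linarith

theorem sum_abs_edgeWeight_sub_le (hn : 0 < n) (F : ColouredGraph (Fin m))
    (h G : ColouredGraph (Fin n)) :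
    (∑ v, |edgeWeight F G v - edgeWeight F h v|) / n ^ m ≤ m ^ 2 * (edgeDiff h G / n ^ 2) := by
  calc _ ≤ (∑ v : Fin m → Fin n, ∑ e ∈ edgePairs F,
          |G.adj (v e.1) (v e.2) - h.adj (v e.1) (v e.2)|) / n ^ m := by
        gcongr with v
        exact abs_prod_sub_prod_le _ (fun _ => ⟨G.adj_nonneg _ _, G.adj_le_one _ _⟩)
          (fun _ => ⟨h.adj_nonneg _ _, h.adj_le_one _ _⟩)
    _ = ∑ e ∈ edgePairs F, edgeDiff h G / n ^ 2 := by
        rw [Finset.sum_comm, Finset.sum_div]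
        refine Finset.sum_congr rfl fun e he => ?_
        have hne : e.1 ≠ e.2 := (mem_edgePairs.1 he).1.ne
        exact sum_pair hn hne fun x y => |G.adj x y - h.adj x y|
    _ ≤ _ := by
        rw [Finset.sum_const, nsmul_eq_mul]
        have hc : ((edgePairs F).card : ℝ) ≤ m ^ 2 := by
          have := (edgePairs F).card_le_univ
          simp only [Fintype.card_prod, Fintype.card_fin] at this
          calc _ ≤ ((m * m : ℕ) : ℝ) := Nat.cast_le.2 this
            _ = _ := by push_cast; ring
        exact mul_le_mul_of_nonneg_right hc (div_nonneg (edgeDiff_nonneg _ _) (by positivity))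

theorem density_toGraphon (hn : 0 < n) (F : ColouredGraph (Fin m)) (G : ColouredGraph (Fin n)) :
    ColouredGraphon.density F G.toGraphon = (∑ v : Fin m → Fin n, edgeWeight F G v *
      ∏ i, if F.colour i then G.col (v i) else 1 - G.col (v i)) / n ^ m := by
  rw [← integral_cell_pi hn, ColouredGraphon.density]
  simp only [toGraphon_κ hn, toGraphon_c hn]
  rfl

theorem density_toGraphon_proj (hn : 0 < n) (F : ColouredGraph (Fin m))
    (G : ColouredGraph (Fin n)) :
    ColouredGraphon.density F G.toGraphon.proj = (∑ v : Fin m → Fin n, edgeWeight F G v *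
      ∏ i, if F.colour i then G.meanCol else 1 - G.meanCol) / n ^ m := by
  rw [← integral_cell_pi hn, ColouredGraphon.density]
  simp only [ColouredGraphon.proj, toGraphon_κ hn, meanColour_toGraphon hn]
  rfl

/-- The effect of replacing the colour of one vertex by the mean colour. -/
noncomputable def colourDefect (F : ColouredGraph (Fin m)) (h G : ColouredGraph (Fin n))
    (i : Fin m) (v : Fin m → Fin n) : ℝ :=
  (∑ u, edgeWeight F h (Function.update v i u) * (G.col u - G.meanCol)) / n

/-- Colours are replaced by the mean one vertex at a time. The remaining colour factors do not
involve the vertex being replaced, so resampling that vertex turns its term into a bounded multiple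
of `colourDefect`. -/
theorem abs_density_sub_density_proj_le_self (hn : 0 < n) (F : ColouredGraph (Fin m))
    (G : ColouredGraph (Fin n)) :
    |ColouredGraphon.density F G.toGraphon - ColouredGraphon.density F G.toGraphon.proj| ≤
      ∑ i, (∑ v, |colourDefect F G G i v|) / n ^ m := by
  have hn' : (0 : ℝ) < n := Nat.cast_pos.2 hn
  rw [density_toGraphon hn, density_toGraphon_proj hn, ← sub_div, ← Finset.sum_sub_distrib]
  set x : Fin n → Fin m → ℝ := fun u i => if F.colour i then G.col u else 1 - G.col u with hx
  set y : Fin m → ℝ := fun i => if F.colour i then G.meanCol else 1 - G.meanCol with hy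
  have hx01 : ∀ u i, 0 ≤ x u i ∧ x u i ≤ 1 := fun u i => by
    have h0 := G.col_nonneg u; have h1 := G.col_le_one u
    simp only [hx]; split_ifs <;> constructor <;> linarith
  have hy01 : ∀ i, 0 ≤ y i ∧ y i ≤ 1 := fun i => by
    have h0 := meanCol_nonneg G; have h1 := meanCol_le_one G
    simp only [hy]; split_ifs <;> constructor <;> linarith
  -- Mean colours before `i`, actual colours after it; coordinate `i` of `v` does not enter.
  set K : Fin m → (Fin m → Fin n) → ℝ := fun i v =>
    (∏ j with j < i, y j) * ∏ j with i < j, x (v j) j with hK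
  have hKb : ∀ i v, |K i v| ≤ 1 := fun i v => by
    rw [abs_of_nonneg (mul_nonneg (Finset.prod_nonneg fun j _ => (hy01 j).1)
      (Finset.prod_nonneg fun j _ => (hx01 _ j).1))]
    exact mul_le_one₀ (Finset.prod_le_one (fun j _ => (hy01 j).1) fun j _ => (hy01 j).2)
      (Finset.prod_nonneg fun j _ => (hx01 _ j).1)
      (Finset.prod_le_one (fun j _ => (hx01 _ j).1) fun j _ => (hx01 _ j).2)
  have hKu : ∀ i v u, K i (Function.update v i u) = K i v := fun i v u => by
    simp only [hK]
    congr 1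
    refine Finset.prod_congr rfl fun j hj => ?_
    rw [Function.update_of_ne (Finset.mem_filter.1 hj).2.ne']
  have htel : ∀ v : Fin m → Fin n, ∏ i, x (v i) i - ∏ i, y i =
      ∑ i, (x (v i) i - y i) * K i v := fun v => by
    have h := Finset.prod_sub_ordered Finset.univ (fun i => x (v i) i)
      (fun i => x (v i) i - y i)
    simp only [sub_sub_cancel] at h
    rw [h, sub_sub_cancel]
    exact Finset.sum_congr rfl fun i _ => by simp only [hK]; ring
  have hsum : ∑ v : Fin m → Fin n, (edgeWeight F G v * ∏ i, x (v i) i -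
      edgeWeight F G v * ∏ i, y i) =
      ∑ i, ∑ v, (edgeWeight F G v * ((x (v i) i - y i) * K i v)) := by
    rw [Finset.sum_comm]
    refine Finset.sum_congr rfl fun v _ => ?_
    rw [← mul_sub, htel, Finset.mul_sum]
  rw [hsum, Finset.sum_div]
  refine (Finset.abs_sum_le_sum_abs _ _).trans (Finset.sum_le_sum fun i _ => ?_)
  rw [abs_div, abs_of_nonneg (by positivity : (0 : ℝ) ≤ n ^ m)]
  gcongr
  have hres := sum_sum_update i fun v => edgeWeight F G v * ((x (v i) i - y i) * K i v)
  rw [mul_comm, ← div_eq_iff hn'.ne'] at hres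
  rw [← hres, Finset.sum_div]
  refine (Finset.abs_sum_le_sum_abs _ _).trans (Finset.sum_le_sum fun v _ => ?_)
  have hxy : ∃ s : ℝ, |s| ≤ 1 ∧ ∀ u, x u i - y i = s * (G.col u - G.meanCol) := by
    by_cases hc : F.colour i
    · exact ⟨1, by simp, fun u => by simp [hx, hy, hc]⟩
    · exact ⟨-1, by simp, fun u => by simp [hx, hy, hc]⟩
  obtain ⟨s, hs, hxy⟩ := hxy
  have e : (∑ u, edgeWeight F G (Function.update v i u) *
      ((x (Function.update v i u i) i - y i) * K i (Function.update v i u))) / n =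
      K i v * s * colourDefect F G G i v := by
    rw [colourDefect, mul_div_assoc', Finset.mul_sum]
    congr 1
    refine Finset.sum_congr rfl fun u _ => ?_
    rw [hKu, Function.update_self, hxy]; ring
  rw [e, abs_mul, abs_mul]
  exact mul_le_of_le_one_left (abs_nonneg _) (mul_le_one₀ (hKb i v) (abs_nonneg _) hs)

/-- Taking the edge weights from `h` instead of `G` makes the test functions deterministic when `h`
is the graph at the start of the window. Each of the `m` defects pays at most `m ^ 2` times the
proportion of changed entries. -/
theorem abs_density_sub_density_proj_le (hn : 0 < n) (F : ColouredGraph (Fin m))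
    (h G : ColouredGraph (Fin n)) :
    |ColouredGraphon.density F G.toGraphon - ColouredGraphon.density F G.toGraphon.proj| ≤
      ∑ i, (∑ v, |colourDefect F h G i v|) / n ^ m + m ^ 3 * (edgeDiff h G / n ^ 2) := by
  have hn' : (0 : ℝ) < n := Nat.cast_pos.2 hn
  have key : ∀ i : Fin m, (∑ v, |colourDefect F G G i v|) / n ^ m ≤
      (∑ v, |colourDefect F h G i v|) / n ^ m + m ^ 2 * (edgeDiff h G / n ^ 2) := by
    intro i
    have h1 : ∀ v, |colourDefect F G G i v| ≤ |colourDefect F h G i v| +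
        (∑ u, |edgeWeight F G (Function.update v i u) -
          edgeWeight F h (Function.update v i u)|) / n := by
      intro v
      have e : colourDefect F G G i v = colourDefect F h G i v +
          (∑ u, (edgeWeight F G (Function.update v i u) -
            edgeWeight F h (Function.update v i u)) * (G.col u - G.meanCol)) / n := by
        simp only [colourDefect, ← add_div, ← Finset.sum_add_distrib]
        congr 1
        exact Finset.sum_congr rfl fun u _ => by ring
      rw [e]
      refine (abs_add_le _ _).trans (add_le_add_right ?_ _)
      rw [abs_div, Nat.abs_cast]
      gcongr
      refine (Finset.abs_sum_le_sum_abs _ _).trans (Finset.sum_le_sum fun u _ => ?_)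
      rw [abs_mul]
      refine mul_le_of_le_one_right (abs_nonneg _) (abs_le.2 ⟨?_, ?_⟩)
      · linarith [G.col_nonneg u, meanCol_le_one G]
      · linarith [G.col_le_one u, meanCol_nonneg G]
    have h2 := sum_sum_update i fun v => |edgeWeight F G v - edgeWeight F h v|
    rw [mul_comm, ← div_eq_iff hn'.ne', Finset.sum_div] at h2
    calc _ ≤ (∑ v, (|colourDefect F h G i v| + (∑ u, |edgeWeight F G (Function.update v i u) -
          edgeWeight F h (Function.update v i u)|) / n)) / n ^ m := by gcongr with v; exact h1 v
      _ = (∑ v, |colourDefect F h G i v|) / n ^ m +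
          (∑ v, |edgeWeight F G v - edgeWeight F h v|) / n ^ m := by
        rw [Finset.sum_add_distrib, h2, add_div]
      _ ≤ _ := by gcongr; exact sum_abs_edgeWeight_sub_le hn F h G
  refine (abs_density_sub_density_proj_le_self hn F G).trans
    ((Finset.sum_le_sum fun i _ => key i).trans_eq ?_)
  rw [Finset.sum_add_distrib]
  simp; ring

/-- The centring moves from the colours to the weights, giving the zero-sum test function that
`transition_sq_sum_col_le` needs. -/
theorem colourDefect_eq (F : ColouredGraph (Fin m)) (h G : ColouredGraph (Fin n))
    (i : Fin m) (v : Fin m → Fin n) :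
    colourDefect F h G i v = (∑ u, (edgeWeight F h (Function.update v i u) -
      (∑ w, edgeWeight F h (Function.update v i w)) / n) * G.col u) / n := by
  simp only [colourDefect, mul_sub, sub_mul, Finset.sum_sub_distrib, ← Finset.sum_mul,
    ← Finset.mul_sum, meanCol]
  ring

end Densities

/-! ### Expected defect of the densities and of the subgraph distance. -/

section SemigroupEstimates

open scoped Matrix
open ColouredGraph

theorem ColouredGraphon.density_mem_Icc {m : ℕ} (F : ColouredGraph (Fin m)) (W : ColouredGraphon) :
    ColouredGraphon.density F W ∈ Icc (0 : ℝ) 1 := by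
  classical
  have hc : ∀ (x : Fin m → I) i, 0 ≤ (if F.colour i then W.c (x i) else 1 - W.c (x i)) ∧
      (if F.colour i then W.c (x i) else 1 - W.c (x i)) ≤ 1 := fun x i => by
    have h := W.c_mem (x i)
    split_ifs <;> constructor <;> linarith [h.1, h.2]
  constructor
  · exact integral_nonneg fun x => mul_nonneg (Finset.prod_nonneg fun e _ => (W.κ_mem _ _).1)
      (Finset.prod_nonneg fun i _ => (hc x i).1)
  · refine (integral_mono_of_nonneg (g := fun _ => (1 : ℝ)) (Eventually.of_forall fun x => ?_)
      (integrable_const _) (Eventually.of_forall fun x => ?_)).trans_eq (by simp)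
    · exact mul_nonneg (Finset.prod_nonneg fun e _ => (W.κ_mem _ _).1)
        (Finset.prod_nonneg fun i _ => (hc x i).1)
    · exact mul_le_one₀ (Finset.prod_le_one (fun e _ => (W.κ_mem _ _).1) fun e _ => (W.κ_mem _ _).2)
        (Finset.prod_nonneg fun i _ => (hc x i).1)
        (Finset.prod_le_one (fun i _ => (hc x i).1) fun i _ => (hc x i).2)

variable {m n : ℕ}

/-- The change of the density of `F` under the projection. -/
noncomputable def densityDefect (F : ColouredGraph (Fin m)) (G : ColouredGraph (Fin n)) : ℝ :=
  |ColouredGraphon.density F G.toGraphon - ColouredGraphon.density F G.toGraphon.proj|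

theorem densityDefect_nonneg (F : ColouredGraph (Fin m)) (G : ColouredGraph (Fin n)) :
    0 ≤ densityDefect F G := abs_nonneg _

theorem densityDefect_le_one (F : ColouredGraph (Fin m)) (G : ColouredGraph (Fin n)) :
    densityDefect F G ≤ 1 := by
  have h1 := ColouredGraphon.density_mem_Icc F G.toGraphon
  have h2 := ColouredGraphon.density_mem_Icc F G.toGraphon.proj
  exact abs_le.2 ⟨by linarith [h1.1, h2.2], by linarith [h1.2, h2.1]⟩

theorem mulVec_sum_apply {S ι : Type*} [Fintype S] (M : Matrix S S ℝ) (s : Finset ι)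
    (f : ι → S → ℝ) (x : S) : (M *ᵥ fun y => ∑ i ∈ s, f i y) x = ∑ i ∈ s, (M *ᵥ f i) x := by
  simp only [Matrix.mulVec, dotProduct, Finset.mul_sum]
  exact Finset.sum_comm

theorem mulVec_div_apply {S : Type*} [Fintype S] (M : Matrix S S ℝ) (f : S → ℝ) (c : ℝ) (x : S) :
    (M *ᵥ fun y => f y / c) x = (M *ᵥ f) x / c := by
  simp only [Matrix.mulVec, dotProduct, Finset.sum_div, mul_div_assoc]

theorem mulVec_add_apply {S : Type*} [Fintype S] (M : Matrix S S ℝ) (f g : S → ℝ) (x : S) :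
    (M *ᵥ fun y => f y + g y) x = (M *ᵥ f) x + (M *ᵥ g) x := by
  simp only [Matrix.mulVec, dotProduct, mul_add, Finset.sum_add_distrib]

theorem mulVec_mul_apply {S : Type*} [Fintype S] (M : Matrix S S ℝ) (f : S → ℝ) (c : ℝ) (x : S) :
    (M *ᵥ fun y => c * f y) x = c * (M *ᵥ f) x := by
  simp only [Matrix.mulVec, dotProduct, Finset.mul_sum, mul_left_comm]

variable {θ : VoterParams}

/-- The bound of `transition_sq_sum_col_le`. -/
noncomputable def decorrelationBound (θ : VoterParams) (δ : ℝ) (n : ℕ) (ε : ℝ) : ℝ :=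
  4 * Real.exp (-(θ.η * δ * n / 2 * ε)) + 4 * θ.η * ε + 8 * θ.η * θ.edgeBound * n * ε ^ 2

theorem decorrelationBound_pos (hθ : θ.Admissible) (δ : ℝ) (n : ℕ) {ε : ℝ} (hε : 0 ≤ ε) :
    0 < decorrelationBound θ δ n ε := by
  have := hθ.η_pos; have := hθ.edgeBound_nonneg
  unfold decorrelationBound; positivity

theorem transition_densityDefect_le_of_wellConnected (hθ : θ.Admissible) (hn : 0 < n) {δ : ℝ}
    {h : ColouredGraph (Fin n)} (hδ : WellConnected δ h) (F : ColouredGraph (Fin m)) {ε : ℝ}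
    (hε : 0 ≤ ε) :
    (transition (generator θ n) ε *ᵥ densityDefect F) h ≤
      m * √(decorrelationBound θ δ n ε) + m ^ 3 * (2 * θ.edgeBound * ε) := by
  have hA := isMarkovGenerator_generator hθ n
  have hn' : (0 : ℝ) < n := Nat.cast_pos.2 hn
  refine (transition_mulVec_mono hA hε (abs_density_sub_density_proj_le hn F h) h).trans ?_
  rw [mulVec_add_apply, mulVec_sum_apply, mulVec_mul_apply, mulVec_div_apply]
  refine add_le_add ?_ ?_
  · refine (Finset.sum_le_sum (g := fun _ => √(decorrelationBound θ δ n ε)) fun i _ => ?_).trans_eq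
      (by simp)
    rw [mulVec_div_apply, mulVec_sum_apply, div_le_iff₀ (by positivity)]
    refine (Finset.sum_le_sum (g := fun _ => √(decorrelationBound θ δ n ε)) fun v _ => ?_).trans_eq
      (by simp [mul_comm])
    refine transition_mulVec_abs_le_sqrt hA hε (decorrelationBound_pos hθ δ n hε) ?_
    simp only [colourDefect_eq]
    have h0 : ∀ u, 0 ≤ edgeWeight F h (Function.update v i u) := fun u => edgeWeight_nonneg F h _
    have h1 : ∀ u, edgeWeight F h (Function.update v i u) ≤ 1 := fun u => edgeWeight_le_one F h _
    have h2 : 0 ≤ (∑ w, edgeWeight F h (Function.update v i w)) / n :=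
      div_nonneg (Finset.sum_nonneg fun u _ => h0 u) hn'.le
    have h3 : (∑ w, edgeWeight F h (Function.update v i w)) / n ≤ 1 :=
      div_le_one_of_le₀ ((Finset.sum_le_sum fun u _ => h1 u).trans_eq (by simp)) hn'.le
    refine transition_sq_sum_col_le hθ hn hδ ?_ (fun u => ?_) hε
    · rw [Finset.sum_sub_distrib]
      simp; field_simp; simp
    · exact abs_le.2 ⟨by linarith [h0 u], by linarith [h1 u]⟩
  · have h1 : (transition (generator θ n) ε *ᵥ fun G => edgeDiff h G) h / n ^ 2 ≤
        2 * θ.edgeBound * ε := by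
      rw [div_le_iff₀ (by positivity)]
      exact (transition_edgeDiff_le hθ h hε).trans_eq (by ring)
    exact mul_le_mul_of_nonneg_left h1 (by positivity)

/-- Markov property at time `t - ε`: on well-connected graphs the window estimate applies, on the
others the defect is at most one. The connectivity constant guaranteed at `t - ε` dominates the one
at `t`, so the latter, free of `ε`, can be used in the bound. -/
theorem transition_densityDefect_le (hθ : θ.Admissible) (hn : 0 < n) {ν : ℝ} (hν : 0 ≤ ν)
    {g : ColouredGraph (Fin n)} (hg : WellConnected ν g) (F : ColouredGraph (Fin m)) {t ε : ℝ}
    (hε : 0 ≤ ε) (hεt : ε ≤ t) :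
    (transition (generator θ n) t *ᵥ densityDefect F) g ≤
      m * √(decorrelationBound θ (Real.exp (-(2 * θ.edgeBound * t)) * ν / 4) n ε) +
        m ^ 3 * (2 * θ.edgeBound * ε) +
        (n : ℝ) ^ 2 * Real.exp (-(Real.exp (-(2 * θ.edgeBound * t)) * ν / 4 * n)) := by
  classical
  have hA := isMarkovGenerator_generator hθ n
  have hs : 0 ≤ t - ε := sub_nonneg.2 hεt
  set δ := Real.exp (-(2 * θ.edgeBound * t)) * ν / 4 with hδ
  set δ' := Real.exp (-(2 * θ.edgeBound * (t - ε))) * ν / 4 with hδ'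
  have hδδ : δ ≤ δ' := by
    have hb := hθ.edgeBound_nonneg
    have : Real.exp (-(2 * θ.edgeBound * t)) ≤ Real.exp (-(2 * θ.edgeBound * (t - ε))) :=
      Real.exp_le_exp.2 (by nlinarith)
    simp only [hδ, hδ']; gcongr
  set C := m * √(decorrelationBound θ δ n ε) + m ^ 3 * (2 * θ.edgeBound * ε) with hC
  have hC0 : 0 ≤ C := by have := hθ.edgeBound_nonneg; positivity
  have hsplit : transition (generator θ n) t *ᵥ densityDefect F =
      transition (generator θ n) (t - ε) *ᵥ (transition (generator θ n) ε *ᵥ densityDefect F) := by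
    rw [Matrix.mulVec_mulVec, ← transition_add, sub_add_cancel]
  have hpt : ∀ h : ColouredGraph (Fin n), (transition (generator θ n) ε *ᵥ densityDefect F) h ≤
      C + if WellConnected δ' h then 0 else 1 := by
    intro h
    split_ifs with hw
    · rw [add_zero]
      exact transition_densityDefect_le_of_wellConnected hθ hn
        (fun u v huv => (mul_le_mul_of_nonneg_right hδδ (Nat.cast_nonneg n)).trans (hw u v huv))
        F hε
    · exact (transition_mulVec_le hA hε (densityDefect_le_one F) h).trans (by linarith)
  rw [hsplit]
  refine (transition_mulVec_mono hA hs hpt g).trans ?_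
  rw [mulVec_add_apply, transition_mulVec_const hA]
  refine add_le_add_right ?_ C
  refine (transition_not_wellConnected_le hθ hs hg).trans ?_
  gcongr

/-- With `ε = n ^ (-3/4)` one has `n ε = n ^ (1/4) → ∞` and `n ε² = n ^ (-1/2) → 0`; any exponent
strictly between `-1` and `-1/2` has both properties. -/
theorem tendsto_decorrelationBound (hθ : θ.Admissible) {δ : ℝ} (hδ : 0 < δ) :
    Tendsto (fun n : ℕ => decorrelationBound θ δ n ((n : ℝ) ^ (-(3 / 4 : ℝ)))) atTop (𝓝 0) := by
  have hη := hθ.η_pos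
  have h1 : Tendsto (fun x : ℝ => 4 * Real.exp (-(θ.η * δ / 2 * x ^ (1 / 4 : ℝ)))) atTop (𝓝 0) := by
    have h := (tendsto_rpow_atTop (by norm_num : (0 : ℝ) < 1 / 4)).const_mul_atTop
      (by positivity : 0 < θ.η * δ / 2)
    simpa using (Real.tendsto_exp_neg_atTop_nhds_zero.comp h).const_mul 4
  have h2 : Tendsto (fun x : ℝ => 4 * θ.η * x ^ (-(3 / 4 : ℝ))) atTop (𝓝 0) := by
    simpa using (tendsto_rpow_neg_atTop (by norm_num : (0 : ℝ) < 3 / 4)).const_mul (4 * θ.η)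
  have h3 : Tendsto (fun x : ℝ => 8 * θ.η * θ.edgeBound * x ^ (-(1 / 2 : ℝ))) atTop (𝓝 0) := by
    simpa using (tendsto_rpow_neg_atTop (by norm_num : (0 : ℝ) < 1 / 2)).const_mul
      (8 * θ.η * θ.edgeBound)
  have h := ((h1.add h2).add h3).comp tendsto_natCast_atTop_atTop
  simp only [add_zero] at h
  refine h.congr' ?_
  filter_upwards [eventually_gt_atTop 0] with n hn
  have hn' : (0 : ℝ) < n := Nat.cast_pos.2 hn
  have e1 : (n : ℝ) ^ (1 / 4 : ℝ) = n * (n : ℝ) ^ (-(3 / 4 : ℝ)) := by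
    nth_rewrite 2 [← Real.rpow_one (n : ℝ)]
    rw [← Real.rpow_add hn']; norm_num
  have e2 : (n : ℝ) ^ (-(1 / 2) : ℝ) = n * ((n : ℝ) ^ (-(3 / 4 : ℝ))) ^ 2 := by
    rw [← Real.rpow_natCast, ← Real.rpow_mul hn'.le]
    nth_rewrite 2 [← Real.rpow_one (n : ℝ)]
    rw [← Real.rpow_add hn']; norm_num
  simp only [Function.comp_apply, decorrelationBound, e1, e2]
  ring_nf

theorem tendsto_transition_densityDefect (hθ : θ.Admissible) {ν : ℝ} (hν : 0 < ν)
    {g : ∀ n, ColouredGraph (Fin n)} (hg : ∀ᶠ n in atTop, WellConnected ν (g n))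
    (F : ColouredGraph (Fin m)) {t : ℝ} (ht : 0 < t) :
    Tendsto (fun n => (transition (generator θ n) t *ᵥ densityDefect F) (g n)) atTop (𝓝 0) := by
  set δ := Real.exp (-(2 * θ.edgeBound * t)) * ν / 4 with hδ
  have hδ0 : 0 < δ := by positivity
  have hε : Tendsto (fun n : ℕ => (n : ℝ) ^ (-(3 / 4 : ℝ))) atTop (𝓝 0) :=
    (tendsto_rpow_neg_atTop (by norm_num : (0 : ℝ) < 3 / 4)).comp tendsto_natCast_atTop_atTop
  have h1 : Tendsto (fun n : ℕ => (m : ℝ) * √(decorrelationBound θ δ n ((n : ℝ) ^ (-(3 / 4 : ℝ)))))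
      atTop (𝓝 0) := by
    simpa using (tendsto_decorrelationBound hθ hδ0).sqrt.const_mul (m : ℝ)
  have h2 : Tendsto (fun n : ℕ => (m : ℝ) ^ 3 * (2 * θ.edgeBound * (n : ℝ) ^ (-(3 / 4 : ℝ))))
      atTop (𝓝 0) := by
    simpa using (hε.const_mul (2 * θ.edgeBound)).const_mul ((m : ℝ) ^ 3)
  have h3 : Tendsto (fun n : ℕ => (n : ℝ) ^ 2 * Real.exp (-(δ * n))) atTop (𝓝 0) := by
    have h := (tendsto_rpow_mul_exp_neg_mul_atTop_nhds_zero 2 δ hδ0).comp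
      tendsto_natCast_atTop_atTop
    simpa [Function.comp_def] using h
  have h := (h1.add h2).add h3
  simp only [add_zero] at h
  refine squeeze_zero' ?_ ?_ h
  · exact Eventually.of_forall fun n => le_transition_mulVec (isMarkovGenerator_generator hθ n) ht.le
      (densityDefect_nonneg F) _
  · filter_upwards [hg, eventually_gt_atTop 0, hε.eventually_le_const ht] with n hgn hn hεt
    exact transition_densityDefect_le hθ hn hν.le hgn F (by positivity) hεt

/-- The distance of a coloured graph to its projection. -/
noncomputable def projDist (F : ℕ → Σ k : ℕ, ColouredGraph (Fin (k + 1)))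
    (G : ColouredGraph (Fin n)) : ℝ := dsub F G.toGraphon G.toGraphon.proj

variable (F : ℕ → Σ k : ℕ, ColouredGraph (Fin (k + 1)))

theorem hasSum_half_pow : HasSum (fun i : ℕ => (2 : ℝ)⁻¹ ^ (i + 1)) 1 := by
  have h := (hasSum_geometric_of_lt_one (by norm_num : (0 : ℝ) ≤ 2⁻¹) (by norm_num)).mul_right 2⁻¹
  simp only [← pow_succ] at h
  have e : (1 - (2 : ℝ)⁻¹)⁻¹ * 2⁻¹ = 1 := by norm_num
  rwa [e] at h

theorem hasSum_projDist (G : ColouredGraph (Fin n)) :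
    HasSum (fun i => (2 : ℝ)⁻¹ ^ (i + 1) * densityDefect (F i).2 G) (projDist F G) := by
  refine (Summable.of_nonneg_of_le (fun i => ?_) (fun i => ?_) hasSum_half_pow.summable).hasSum
  · exact mul_nonneg (by positivity) (densityDefect_nonneg _ _)
  · exact mul_le_of_le_one_right (by positivity) (densityDefect_le_one _ _)

theorem projDist_nonneg (G : ColouredGraph (Fin n)) : 0 ≤ projDist F G :=
  (hasSum_projDist F G).nonneg fun i => mul_nonneg (by positivity) (densityDefect_nonneg _ _)

/-- Each term of the series tends to zero and is dominated by its geometric weight, since defects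
are at most one. -/
theorem tendsto_transition_projDist (hθ : θ.Admissible) {ν : ℝ} (hν : 0 < ν)
    {g : ∀ n, ColouredGraph (Fin n)} (hg : ∀ᶠ n in atTop, WellConnected ν (g n))
    {t : ℝ} (ht : 0 < t) :
    Tendsto (fun n => (transition (generator θ n) t *ᵥ projDist F) (g n)) atTop (𝓝 0) := by
  have e : ∀ n, (transition (generator θ n) t *ᵥ projDist F) (g n) =
      ∑' i, (2 : ℝ)⁻¹ ^ (i + 1) *
        (transition (generator θ n) t *ᵥ densityDefect (F i).2) (g n) := by
    intro n
    have h := hasSum_sum (s := Finset.univ) fun G (_ : G ∈ Finset.univ) =>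
      (hasSum_projDist F G).mul_left (transition (generator θ n) t (g n) G)
    have h' : (transition (generator θ n) t *ᵥ projDist F) (g n) =
        ∑ G, transition (generator θ n) t (g n) G * projDist F G := rfl
    rw [h', ← h.tsum_eq]
    refine tsum_congr fun i => ?_
    rw [← mulVec_mul_apply]
    rfl
  simp only [e]
  have h := tendsto_tsum_of_dominated_convergence (𝓕 := atTop)
    (f := fun n i => (2 : ℝ)⁻¹ ^ (i + 1) *
      (transition (generator θ n) t *ᵥ densityDefect (F i).2) (g n)) (g := fun _ => 0)
    (bound := fun i : ℕ => (2 : ℝ)⁻¹ ^ (i + 1)) hasSum_half_pow.summable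
    (fun i => by
      simpa using (tendsto_transition_densityDefect hθ hν hg (F i).2 ht).const_mul
        ((2 : ℝ)⁻¹ ^ (i + 1)))
    (Eventually.of_forall fun n i => by
      have hA := isMarkovGenerator_generator hθ n
      rw [Real.norm_of_nonneg (mul_nonneg (by positivity)
        (le_transition_mulVec hA ht.le (densityDefect_nonneg _) _))]
      exact mul_le_of_le_one_right (by positivity)
        (transition_mulVec_le hA ht.le (densityDefect_le_one _) _))
  simpa using h

end SemigroupEstimates

/-! ### Measurability of chain paths and passage from expectations to the semigroup. -/

section Paths

theorem comp_eq_sum_indicator {S Ω : Type*} [Fintype S] (f : S → ℝ) (Y : Ω → S) :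
    (fun ω => f (Y ω)) = fun ω => ∑ y, {ω | Y ω = y}.indicator (fun _ => f y) ω := by
  classical
  funext ω
  simp [Set.indicator_apply]

open scoped Matrix

/-- Measurable approximation of a time from the right by countably many times. -/
theorem exists_discrete_approx_right : ∃ (c : ℕ → ℝ≥0 → ℕ) (b : ℕ → ℕ → ℝ≥0),
    (∀ k, Measurable (c k)) ∧ ∀ t, Tendsto (fun k => b k (c k t)) atTop (𝓝[≥] t) := by
  -- The `+ 1` in the numerator keeps the approximating times to the right of `t`, where
  -- right-continuity applies. They depend on `t` only through a natural number, which reduces joint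
  -- measurability to countably many fixed times.
  refine ⟨fun k t => ⌊t * (k + 1)⌋₊, fun k j => (j + 1) / (k + 1), fun k =>
    Nat.measurable_floor.comp (measurable_id.mul_const _), fun t => ?_⟩
  have hgt : ∀ k : ℕ, t ≤ ((⌊t * (k + 1)⌋₊ : ℝ≥0) + 1) / (k + 1) := fun k => by
    rw [le_div_iff₀ (by positivity)]
    exact (Nat.lt_floor_add_one _).le
  have hle : ∀ k : ℕ, ((⌊t * (k + 1)⌋₊ : ℝ≥0) + 1) / (k + 1) ≤ t + 1 / (k + 1) := fun k => by
    rw [add_div]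
    gcongr
    rw [div_le_iff₀ (by positivity)]
    exact Nat.floor_le (by positivity)
  refine tendsto_nhdsWithin_iff.2 ⟨?_, Eventually.of_forall hgt⟩
  refine tendsto_of_tendsto_of_tendsto_of_le_of_le tendsto_const_nhds ?_ hgt hle
  simpa using (tendsto_one_div_add_atTop_nhds_zero_nat (𝕜 := ℝ≥0)).const_add t

variable {S : Type*} [Fintype S] [DecidableEq S] {A : (S → ℝ) →ₗ[ℝ] (S → ℝ)}
  {Ω : Type*} [MeasurableSpace Ω] {P : Measure Ω} {X : ℝ≥0 → Ω → S}

theorem IsMarkovChain.measurable_comp (hX : IsMarkovChain A P X) (f : S → ℝ) (t : ℝ≥0) :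
    Measurable fun ω => f (X t ω) := by
  rw [comp_eq_sum_indicator]
  exact Finset.measurable_fun_sum _ fun y _ =>
    measurable_const.indicator (hX.measurableSet_eq t y)

theorem IsMarkovChain.integral_comp [IsProbabilityMeasure P] (hX : IsMarkovChain A P X) {x : S}
    (hx : ∀ᵐ ω ∂P, X 0 ω = x) (f : S → ℝ) (t : ℝ≥0) :
    ∫ ω, f (X t ω) ∂P = (transition A t *ᵥ f) x := by
  have h1 : ∀ y, P.real {ω | X t ω = y} = transition A t x y := fun y => by
    have h := hX.markov 1 ![0, t] (by
      intro i j hij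
      fin_cases i <;> fin_cases j <;> simp_all) ![x, y]
    have h0 : P.real {ω | X 0 ω = x} = 1 := by
      rw [← probReal_univ (μ := P)]
      refine measureReal_congr ?_
      filter_upwards [hx] with ω hω
      exact propext ⟨fun _ => trivial, fun _ => hω⟩
    have h2 : P.real {ω | ∀ i : Fin (1 + 1), X (![0, t] i) ω = ![x, y] i} =
        P.real {ω | X t ω = y} := by
      refine measureReal_congr ?_
      filter_upwards [hx] with ω hω
      exact propext ⟨fun h => h 1, fun h => Fin.forall_fin_two.2 ⟨hω, h⟩⟩
    rw [h2, Fin.prod_univ_one] at h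
    change _ = P.real {ω | X 0 ω = x} * transition A ((t : ℝ) - (0 : ℝ≥0)) x y at h
    rwa [h0, one_mul, NNReal.coe_zero, sub_zero] at h
  rw [comp_eq_sum_indicator, integral_finsetSum _ fun y _ =>
    (integrable_const _).indicator (hX.measurableSet_eq t y)]
  simp only [integral_indicator_const _ (hX.measurableSet_eq t _), h1, smul_eq_mul]
  rfl

/-- A right-continuous chain is jointly measurable in time and chance. -/
theorem IsMarkovChain.measurable_uncurry (hX : IsMarkovChain A P X) (f : S → ℝ) :
    Measurable fun p : ℝ≥0 × Ω => f (X p.1 p.2) := by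
  obtain ⟨c, b, hc, hlim⟩ := exists_discrete_approx_right
  refine measurable_of_tendsto_metrizable (f := fun k (p : ℝ≥0 × Ω) => f (X (b k (c k p.1)) p.2))
    (fun k => ?_) (tendsto_pi_nhds.2 fun p => ?_)
  · have h1 : Measurable fun q : ℕ × Ω => f (X (b k q.1) q.2) :=
      measurable_from_prod_countable_right fun j => hX.measurable_comp f (b k j)
    exact h1.comp (((hc k).comp measurable_fst).prodMk measurable_snd)
  · refine tendsto_const_nhds.congr' ?_
    filter_upwards [(hlim p.1).eventually (hX.right_continuous p.2 p.1)] with k hk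
    rw [hk]

variable {f : S → ℝ}

theorem IsMarkovChain.integrable_uncurry [IsProbabilityMeasure P] (hX : IsMarkovChain A P X)
    (hf : ∀ x, |f x| ≤ 1) :
    Integrable (fun p : ℝ × Ω => f (X p.1.toNNReal p.2) * Real.exp (-p.1))
      ((volume.restrict (Ioi 0)).prod P) := by
  have hb : Integrable (fun p : ℝ × Ω => Real.exp (-p.1)) ((volume.restrict (Ioi 0)).prod P) := by
    have h := exp_neg_integrableOn_Ioi 0 one_pos
    simp only [neg_mul, one_mul] at h
    exact Integrable.comp_fst h P
  refine hb.mono' (Measurable.aestronglyMeasurable ?_) (Eventually.of_forall fun p => ?_)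
  · exact ((hX.measurable_uncurry f).comp
      ((measurable_real_toNNReal.comp measurable_fst).prodMk measurable_snd)).mul
      (Real.measurable_exp.comp measurable_fst.neg)
  · rw [norm_mul, Real.norm_eq_abs, Real.norm_of_nonneg (Real.exp_nonneg _)]
    exact mul_le_of_le_one_left (Real.exp_nonneg _) (hf _)

theorem IsMarkovChain.integrableOn_path (hX : IsMarkovChain A P X) (hf : ∀ x, |f x| ≤ 1) (ω : Ω) :
    IntegrableOn (fun t : ℝ => f (X t.toNNReal ω) * Real.exp (-t)) (Ioi 0) := by
  have h := exp_neg_integrableOn_Ioi 0 one_pos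
  simp only [neg_mul, one_mul] at h
  refine Integrable.mono' h (Measurable.aestronglyMeasurable ?_) (Eventually.of_forall fun t => ?_)
  · exact ((hX.measurable_uncurry f).comp
      (measurable_real_toNNReal.prodMk measurable_const)).mul
      (Real.measurable_exp.comp measurable_neg)
  · rw [norm_mul, Real.norm_eq_abs, Real.norm_of_nonneg (Real.exp_nonneg _)]
    exact mul_le_of_le_one_left (Real.exp_nonneg _) (hf _)

/-- Fubini, and then the law of the chain at each single time; after this the probability space no
longer matters. -/
theorem IsMarkovChain.integral_integral_eq [IsProbabilityMeasure P] (hX : IsMarkovChain A P X)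
    {x : S} (hx : ∀ᵐ ω ∂P, X 0 ω = x) (hf : ∀ x, |f x| ≤ 1) :
    ∫ ω, (∫ t in Ioi (0 : ℝ), f (X t.toNNReal ω) * Real.exp (-t)) ∂P =
      ∫ t in Ioi (0 : ℝ), (transition A t *ᵥ f) x * Real.exp (-t) := by
  rw [← integral_integral_swap (hX.integrable_uncurry hf)]
  refine setIntegral_congr_fun measurableSet_Ioi fun t ht => ?_
  simp only [integral_mul_const]
  rw [hX.integral_comp hx, Real.coe_toNNReal _ (le_of_lt ht)]

end Paths

/-! ### Conclusion: dominated convergence in time. -/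

theorem lemma10 (θ : VoterParams) (hη : 0 < θ.η) (hρ : 0 < θ.ρ)
    (hc0 : 0 ≤ θ.sc0) (hc1 : 0 ≤ θ.sc1) (hd0 : 0 ≤ θ.sd0) (hd1 : 0 ≤ θ.sd1)
    (F : ℕ → Σ k : ℕ, ColouredGraph (Fin (k + 1))) (hF : IsEnumeration F)
    (Ω : ℕ → Type*) [∀ n, MeasurableSpace (Ω n)]
    (P : ∀ n, Measure (Ω n)) [∀ n, IsProbabilityMeasure (P n)]
    (G : ∀ n, ℝ≥0 → Ω n → ColouredGraph (Fin n))
    (hG : ∀ n, IsMarkovChain (generator θ n) (P n) (G n))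
    (g : ∀ n, ColouredGraph (Fin n)) (hg : ∀ n, ∀ᵐ ω ∂(P n), G n 0 ω = g n)
    (W : ColouredGraphon)
    (hW : Tendsto (fun n => dsub F (g n).toGraphon W) atTop (𝓝 0))
    (hν : 0 < liminf (fun n => (g n).toGraphon.connectedness) atTop) :
    (∀ n ω, IntegrableOn (pathIntegrand (dsub F)
      (fun t => (G n t ω).toGraphon) (fun t => (G n t ω).toGraphon.proj)) (Ioi 0)) ∧
    (∀ n, Integrable (fun ω => dpath (dsub F)
      (fun t => (G n t ω).toGraphon) (fun t => (G n t ω).toGraphon.proj)) (P n)) ∧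
    Tendsto (fun n => ∫ ω, dpath (dsub F)
      (fun t => (G n t ω).toGraphon) (fun t => (G n t ω).toGraphon.proj) ∂(P n))
      atTop (𝓝 0) := by
  have hθ : θ.Admissible := ⟨hη, hρ, hc0, hc1, hd0, hd1⟩
  have hf0 : ∀ n (H : ColouredGraph (Fin n)), 0 ≤ min 1 (projDist F H) := fun n H =>
    le_min zero_le_one (projDist_nonneg F H)
  have hf : ∀ n (H : ColouredGraph (Fin n)), |min 1 (projDist F H)| ≤ 1 := fun n H => by
    rw [abs_of_nonneg (hf0 n H)]; exact min_le_left _ _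
  refine ⟨fun n ω => (hG n).integrableOn_path (hf n) ω,
    fun n => ((hG n).integrable_uncurry (hf n)).integral_prod_right, ?_⟩
  have hconn : ∃ ν > 0, ∀ᶠ n in atTop, WellConnected ν (g n) := by
    obtain ⟨ν, hν0, hν⟩ := exists_between hν
    refine ⟨ν, hν0, ?_⟩
    -- A real `liminf` gives eventual lower bounds only for a sequence bounded below; here zero is a
    -- bound.
    have hbdd : IsBoundedUnder (· ≥ ·) atTop fun n => (g n).toGraphon.connectedness :=
      isBoundedUnder_of ⟨0, fun n => Real.iInf_nonneg fun p => integral_nonneg fun z =>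
        mul_nonneg ((g n).toGraphon.κ_mem _ _).1 ((g n).toGraphon.κ_mem _ _).1⟩
    filter_upwards [eventually_lt_of_lt_liminf hν hbdd] with n hn
    exact wellConnected_of_le_connectedness hn.le
  obtain ⟨ν, hν0, hconn⟩ := hconn
  have e : ∀ n, ∫ ω, dpath (dsub F) (fun t => (G n t ω).toGraphon)
      (fun t => (G n t ω).toGraphon.proj) ∂(P n) =
      ∫ t in Ioi (0 : ℝ), (transition (generator θ n) t).mulVec
        (fun H => min 1 (projDist F H)) (g n) * Real.exp (-t) := fun n =>
    (hG n).integral_integral_eq (hg n) (hf n)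
  simp only [e]
  have hexp := exp_neg_integrableOn_Ioi 0 one_pos
  simp only [neg_mul, one_mul] at hexp
  have hA := fun n => isMarkovGenerator_generator hθ n
  -- The limit is written as the integral of the zero function, so that dominated convergence
  -- applies with majorant `exp (-t)`.
  refine Eq.subst (motive := fun z => Tendsto _ atTop (𝓝 z))
    (integral_zero ℝ ℝ (μ := volume.restrict (Ioi 0))) ?_
  refine tendsto_integral_of_dominated_convergence _ (fun n => ?_) hexp (fun n => ?_) ?_
  · have hcont : Continuous fun t => (transition (generator θ n) t).mulVec
        (fun H => min 1 (projDist F H)) (g n) :=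
      continuous_iff_continuousAt.2 fun t => (hasDerivAt_transition_mulVec (generator θ n)
        (F := fun _ H => min 1 (projDist F H)) (F' := 0)
        (fun H => hasDerivAt_const _ _) (g n)).continuousAt
    exact (hcont.mul (by fun_prop)).aestronglyMeasurable
  · filter_upwards [ae_restrict_mem measurableSet_Ioi] with t ht
    rw [norm_mul, Real.norm_of_nonneg (le_transition_mulVec (hA n) (le_of_lt ht) (hf0 n) _),
      Real.norm_of_nonneg (Real.exp_nonneg _)]
    exact mul_le_of_le_one_left (Real.exp_nonneg _)
      (transition_mulVec_le (hA n) (le_of_lt ht) (fun H => min_le_left _ _) _)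
  · filter_upwards [ae_restrict_mem measurableSet_Ioi] with t ht
    have h := squeeze_zero
      (fun n => le_transition_mulVec (hA n) (le_of_lt ht) (hf0 n) (g n))
      (fun n => transition_mulVec_mono (hA n) (le_of_lt ht) (fun H => min_le_right _ _) (g n))
      (tendsto_transition_projDist F hθ hν0 hconn ht)
    simpa using h.mul_const (Real.exp (-t))
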